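/- Let $n\in\mathbb N$, $a<b$, $\tau>0$, $A_d\in L_\infty^{n\times 3n}[a,b]$ and $B\in\mathbb R^{2n\times 4n}$. Write $L_2^n[a,b]$, $L_2^n[[0,1]\times[a,b]]$ for the square-integrable $\mathbb R^n$-valued functions of $x\in[a,b]$, respectively of $(s,x)\in[0,1]\times[a,b]$; $H_2^n[a,b]$ for the functions with weak derivatives $\partial_x^ju\in L_2^n$, $j\le 2$; and $H_{(1,2)}^n$ for the functions $\phi(s,x)$ with weak derivatives $\partial_s^i\partial_x^j\phi\in L_2^n$, $i\le1$, $j\le2$, each with its Sobolev norm. Set $$X_B=\{u\in H_2^n[a,b] : B\,(u(a),u(b),u_x(a),u_x(b))^{T}=0\},$$ $$Y_u=\{\phi\in H_{(1,2)}^n : \phi(0,\cdot)=u,\ \phi(s,\cdot)\in X_B\ \text{for all } s\in[0,1]\}.$$ Let $$H=\begin{bmatrix} I&0\\ I&(b-a)I\\0&I\\0&I\end{bmatrix},\quad Q(x,\theta)=\begin{bmatrix}0\\(b-\theta)I\\0\\I\end{bmatrix},\quad K(x)=\begin{bmatrix}I&(x-a)I\end{bmatrix}$$ and suppose that $BH\in\mathbb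 R^{2n\times2n}$ is invertible. Put $T_2(x,\theta)=-K(x)(BH)^{-1}BQ(x,\theta)$, $T_1(x,\theta)=(x-\theta)I+T_2(x,\theta)$ and define $$(\mathcal T_1u)(x)=\int_a^xT_1(x,\theta)u(\theta)\,d\theta+\int_x^bT_2(x,\theta)u(\theta)\,d\theta,$$ $$(\mathcal A_{11,d}u)(x)=A_d(x)\begin{bmatrix}0\\0\\I\end{bmatrix}u(x)+\int_a^xA_d(x)\begin{bmatrix}T_1\\ \partial_xT_1\\0\end{bmatrix}(x,\theta)\,u(\theta)\,d\theta+\int_x^bA_d(x)\begin{bmatrix}T_2\\ \partial_xT_2\\0\end{bmatrix}(x,\theta)\,u(\theta)\,d\theta,$$ $$(\mathcal T_2\psi)(s)=\int_0^s\mathcal T_1\psi(\theta)\,d\theta,\qquad (\mathcal A_{22}\psi)(s)=-\tfrac1\tau\mathcal T_1\psi(s),\qquad \mathcal A_{12}\psi=\int_0^1\mathcal A_{11,d}\psi(s)\,ds .$$ Let an input $v(t)\in L_2^n[a,b]$, $t\ge0$, be given. **PDE.** $(\phi,p)$ solves the transport PDE with initial state $\phi_0$ if $\phi:[0,\infty)\to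 H_{(1,2)}^n$ is Fréchet differentiable (in the norm of $H_{(1,2)}^n$), $\phi(0)=\phi_0$, $p(t)\in L_2^n[a,b]$, and for all $t\ge0$ $$\phi_t(t)=-\tfrac1\tau\phi_s(t),\qquad \phi(t)\in Y_{\mathcal T_1v(t)},\qquad p(t)=A_d\begin{bmatrix}\phi(t,1)\\\phi_x(t,1)\\\phi_{xx}(t,1)\end{bmatrix}.$$ **PIE.** $(\psi,p)$ solves the PIE with initial state $\psi_0$ if $v:[0,\infty)\to L_2^n[a,b]$ and $\psi:[0,\infty)\to L_2^n[[0,1]\times[a,b]]$ are Fréchet differentiable (in the $L_2$ norms), $\psi(0)=\psi_0$, $p(t)\in L_2^n[a,b]$, and for all $t\ge0$ $$\mathcal T_1v_t(t)+\mathcal T_2\psi_t(t)=\mathcal A_{22}\psi(t),\qquad p(t)=\mathcal A_{11,d}v(t)+\mathcal A_{12}\psi(t).$$ Then the following hold. 1. For all $\psi(t)\in L_2^n[[0,1]\times[a,b]]$, $p(t)\in L_2^n[a,b]$ ($t\ge 0$) and $\psi_0\in L_2^n[[0,1]\times[a,b]]$: $(\psi,p)$ solves the PIE with initial state $\psi_0$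 if and only if $(\phi,p)$ with $\phi=\mathcal T_1v+\mathcal T_2\psi$ solves the PDE with initial state $\phi_0=\mathcal T_1v(0)+\mathcal T_2\psi_0$. 2. Conversely, for all $\phi(t)\in Y_{\mathcal T_1v(t)}$, $p(t)\in L_2^n[a,b]$ ($t\ge0$) and $\phi_0\in Y_{\mathcal T_1v(0)}$: $(\phi,p)$ solves the PDE with initial state $\phi_0$ if and only if $(\psi,p)$ with $\psi=\partial_s\partial_x^2\phi$ solves the PIE with initial state $\psi_0=\partial_s\partial_x^2\phi_0$. -/

import Mathlib

open MeasureTheory Set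
open scoped ContDiff

noncomputable section

namespace DelayPIE

/-! ### Function spaces -/

/-- The values of all states: `ℝⁿ` with the Euclidean norm. -/
abbrev E (n : ℕ) := EuclideanSpace ℝ (Fin n)

/-- Lebesgue measure on `[a,b]`. -/
abbrev μ₁ (a b : ℝ) : Measure ℝ := volume.restrict (Icc a b)

/-- Lebesgue measure on `[0,1] × [a,b]`; points are written `(s, x)`. -/
abbrev μ₂ (a b : ℝ) : Measure (ℝ × ℝ) := volume.restrict (Icc 0 1 ×ˢ Icc a b)

/-- `L₂ⁿ` on the interval `[a,b]`. -/
abbrev L2x (n : ℕ) (a b : ℝ) := Lp (E n) 2 (μ₁ a b)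

/-- `L₂ⁿ` on the rectangle `[0,1] × [a,b]`. -/
abbrev L2sx (n : ℕ) (a b : ℝ) := Lp (E n) 2 (μ₂ a b)

/-- Test functions `C_c^∞(U)`. -/
structure IsTest {V : Type*} [NormedAddCommGroup V] [NormedSpace ℝ V] (U : Set V)
    (η : V → ℝ) : Prop where
  smooth : ContDiff ℝ ∞ η
  compact : HasCompactSupport η
  supp : tsupport η ⊆ U

/-- The directional derivative of a function in the constant direction `e`. -/
def dirDeriv {V : Type*} [NormedAddCommGroup V] [NormedSpace ℝ V] (e : V) (η : V → ℝ) : V → ℝ :=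
  fun z => fderiv ℝ η z e

/-- The classical partial derivative `∂_s^i ∂_x^j η` of a function of `(s, x)`. -/
def partialDeriv (i j : ℕ) (η : ℝ × ℝ → ℝ) : ℝ × ℝ → ℝ :=
  (dirDeriv ((1, 0) : ℝ × ℝ))^[i] ((dirDeriv ((0, 1) : ℝ × ℝ))^[j] η)

/-- `w` is the weak derivative `∂_x^j u` on `(a,b)`. -/
def IsWeakDeriv₁ {n : ℕ} {a b : ℝ} (j : ℕ) (u w : L2x n a b) : Prop :=
  ∀ η : ℝ → ℝ, IsTest (Ioo a b) η →
    ∫ x, (dirDeriv (1 : ℝ))^[j] η x • u x ∂(μ₁ a b) = (-1 : ℝ) ^ j • ∫ x, η x • w x ∂(μ₁ a b)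

/-- `w` is the weak derivative `∂_s^i ∂_x^j φ` on `(0,1) × (a,b)`. -/
def IsWeakDeriv₂ {n : ℕ} {a b : ℝ} (i j : ℕ) (φ w : L2sx n a b) : Prop :=
  ∀ η : ℝ × ℝ → ℝ, IsTest (Ioo 0 1 ×ˢ Ioo a b) η →
    ∫ z, partialDeriv i j η z • φ z ∂(μ₂ a b)
      = (-1 : ℝ) ^ (i + j) • ∫ z, η z • w z ∂(μ₂ a b)

section Helpers

variable {V : Type*} [NormedAddCommGroup V] [NormedSpace ℝ V]

lemma IsTest.dirDeriv {U : Set V} {η : V → ℝ} (h : IsTest U η) (e : V) :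
    IsTest U (dirDeriv e η) where
  smooth := (h.smooth.fderiv_right (m := ∞) (by simp)).clm_apply contDiff_const
  compact := h.compact.fderiv_apply (𝕜 := ℝ) e
  supp := (tsupport_fderiv_apply_subset ℝ e).trans h.supp

lemma IsTest.iterate {U : Set V} {η : V → ℝ} (h : IsTest U η) (e : V) (k : ℕ) :
    IsTest U ((DelayPIE.dirDeriv e)^[k] η) := by
  induction k with
  | zero => exact h
  | succ k ih => rw [Function.iterate_succ_apply']; exact ih.dirDeriv e

lemma IsTest.integrable_smul [MeasurableSpace V] [BorelSpace V] {n : ℕ} {μ : Measure V}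
    [IsFiniteMeasure μ] {U : Set V} {η : V → ℝ} (h : IsTest U η) (u : Lp (E n) 2 μ) :
    Integrable (fun x => η x • u x) μ :=
  ((Lp.memLp u).integrable (by norm_num)).locallyIntegrable.integrable_smul_left_of_hasCompactSupport
    h.smooth.continuous h.compact

lemma integral_smul_add [MeasurableSpace V] [BorelSpace V] {n : ℕ} {μ : Measure V}
    [IsFiniteMeasure μ] {U : Set V} {η : V → ℝ} (h : IsTest U η) (u v : Lp (E n) 2 μ) :
    ∫ x, η x • (u + v : Lp (E n) 2 μ) x ∂μ = ∫ x, η x • u x ∂μ + ∫ x, η x • v x ∂μ := by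
  rw [← integral_add (h.integrable_smul u) (h.integrable_smul v)]
  refine integral_congr_ae ?_
  filter_upwards [Lp.coeFn_add u v] with x hx
  rw [hx, Pi.add_apply, smul_add]

lemma integral_smul_smul {W : Type*} [MeasurableSpace W] {n : ℕ} {μ : Measure W}
    (η : W → ℝ) (c : ℝ) (u : Lp (E n) 2 μ) :
    ∫ x, η x • (c • u : Lp (E n) 2 μ) x ∂μ = c • ∫ x, η x • u x ∂μ := by
  rw [← integral_smul]
  refine integral_congr_ae ?_
  filter_upwards [Lp.coeFn_smul c u] with x hx
  simp only [hx, Pi.smul_apply]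
  rw [smul_comm]

lemma integral_smul_zero {W : Type*} [MeasurableSpace W] {n : ℕ} {μ : Measure W} (η : W → ℝ) :
    ∫ x, η x • (0 : Lp (E n) 2 μ) x ∂μ = 0 := by
  simpa using integral_smul_smul η 0 (0 : Lp (E n) 2 μ)

instance (a b : ℝ) : IsFiniteMeasure (μ₂ a b) :=
  ⟨by
    rw [Measure.restrict_apply_univ]
    exact (isCompact_Icc.prod isCompact_Icc).measure_lt_top⟩

end Helpers

/-- The Sobolev space `H₂ⁿ[a,b]`: an element is recorded as the triple of a function and its weak
derivatives of order `0, 1, 2`, all in `L₂`. Component `0` is the function itself, which determines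
the others. The norm is the maximum of the `L₂` norms of these derivatives. -/
def H2 (n : ℕ) (a b : ℝ) : Submodule ℝ (Fin 3 → L2x n a b) where
  carrier := {w | ∀ j : Fin 3, IsWeakDeriv₁ j (w 0) (w j)}
  zero_mem' := by
    intro j η _
    simp only [Pi.zero_apply, integral_smul_zero, smul_zero]
  add_mem' := by
    intro u v hu hv j η hη
    simp only [Pi.add_apply]
    rw [integral_smul_add (hη.iterate 1 j), integral_smul_add hη, smul_add, hu j η hη, hv j η hη]
  smul_mem' := by
    intro c u hu j η hη
    simp only [Pi.smul_apply]
    rw [integral_smul_smul, integral_smul_smul, hu j η hη, smul_comm]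

/-- The Sobolev space `H_{(1,2)}ⁿ[[0,1] × [a,b]]`: an element is recorded as the family of the weak
derivatives `∂_s^i ∂_x^j φ`, `i ≤ 1`, `j ≤ 2`, all in `L₂`. Component `(0,0)` is the function `φ`
itself, which determines the others. The norm is the maximum of the `L₂` norms of these
derivatives (equivalent to the Hilbert norm of the Sobolev space). -/
def H12 (n : ℕ) (a b : ℝ) : Submodule ℝ (Fin 2 × Fin 3 → L2sx n a b) where
  carrier := {w | ∀ (i : Fin 2) (j : Fin 3), IsWeakDeriv₂ i j (w (0, 0)) (w (i, j))}
  zero_mem' := by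
    intro i j η _
    simp only [Pi.zero_apply, integral_smul_zero, smul_zero]
  add_mem' := by
    intro u v hu hv i j η hη
    simp only [Pi.add_apply]
    have h' : IsTest _ (partialDeriv i j η) := (hη.iterate (0, 1) j).iterate (1, 0) i
    rw [integral_smul_add h', integral_smul_add hη, smul_add, hu i j η hη, hv i j η hη]
  smul_mem' := by
    intro c u hu i j η hη
    simp only [Pi.smul_apply]
    rw [integral_smul_smul, integral_smul_smul, hu i j η hη, smul_comm]

/-- The derivative `∂_x^j u` of `u ∈ H₂`. -/
def H2.d {n : ℕ} {a b : ℝ} (j : Fin 3) (u : H2 n a b) : L2x n a b := u.1 j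

/-- The derivative `∂_s^i ∂_x^j φ` of `φ ∈ H_{(1,2)}`. -/
def H12.d {n : ℕ} {a b : ℝ} (i : Fin 2) (j : Fin 3) (φ : H12 n a b) : L2sx n a b := φ.1 (i, j)

/-! ### Domains of the PDE -/

/-- `u ∈ X_B`: the element `u ∈ H₂` satisfies `B (u(a), u(b), u_x(a), u_x(b)) = 0`, where the
boundary values are those of the continuous representatives `f` of `u` and `g` of `u_x`. -/
def MemX {n : ℕ} {a b : ℝ} (B : Matrix (Fin 2 × Fin n) (Fin 4 × Fin n) ℝ) (u : H2 n a b) : Prop :=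
  ∃ f g : ℝ → E n, ContinuousOn f (Icc a b) ∧ f =ᵐ[μ₁ a b] H2.d 0 u ∧
    ContinuousOn g (Icc a b) ∧ g =ᵐ[μ₁ a b] H2.d 1 u ∧
    B.mulVec (fun p => (![f a, f b, g a, g b] p.1) p.2) = 0

/-- `S s = φ(s,·)` for `s ∈ [0,1]`: the slices of `φ ∈ H_{(1,2)}` at all (not only almost all)
`s ∈ [0,1]`, given by the representative of `φ` in `C([0,1]; H₂[a,b])`. -/
def IsSlices {n : ℕ} {a b : ℝ} (φ : H12 n a b) (S : ℝ → H2 n a b) : Prop :=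
  ContinuousOn S (Icc 0 1) ∧
    ∀ᵐ s ∂(volume.restrict (Icc (0 : ℝ) 1)), ∀ᵐ x ∂(μ₁ a b),
      H2.d 0 (S s) x = H12.d 0 0 φ (s, x)

/-- `Y_u`: all `φ ∈ H_{(1,2)}` with `φ(0,·) = u` and `φ(s,·) ∈ X_B` for all `s ∈ [0,1]`. -/
def Y {n : ℕ} {a b : ℝ} (B : Matrix (Fin 2 × Fin n) (Fin 4 × Fin n) ℝ) (u : ℝ → E n) :
    Set (H12 n a b) :=
  {φ | ∃ S : ℝ → H2 n a b, IsSlices φ S ∧ H2.d 0 (S 0) =ᵐ[μ₁ a b] u ∧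
    ∀ s ∈ Icc (0 : ℝ) 1, MemX B (S s)}

/-! ### The PI operators -/

/-- A matrix acting on a vector of `ℝⁿ`. -/
def act {n : ℕ} (M : Matrix (Fin n) (Fin n) ℝ) (u : E n) : E n := WithLp.toLp 2 (M.mulVec u.ofLp)

/-- The 3-PI operator with parameters `R₀, R₁, R₂`:
`R₀(x) u(x) + ∫_a^x R₁(x,θ) u(θ) dθ + ∫_x^b R₂(x,θ) u(θ) dθ`. -/
def pi3 {n : ℕ} (a b : ℝ) (R₀ : ℝ → Matrix (Fin n) (Fin n) ℝ)
    (R₁ R₂ : ℝ → ℝ → Matrix (Fin n) (Fin n) ℝ) (u : ℝ → E n) (x : ℝ) : E n :=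
  act (R₀ x) (u x) + (∫ θ in a..x, act (R₁ x θ) (u θ)) + ∫ θ in x..b, act (R₂ x θ) (u θ)

/-- `H`, with block rows `(I, 0)`, `(I, (b-a) I)`, `(0, I)`, `(0, I)`. -/
def Hmat (n : ℕ) (a b : ℝ) : Matrix (Fin 4 × Fin n) (Fin 2 × Fin n) ℝ :=
  Matrix.of fun p q =>
    (!![1, 0; 1, b - a; 0, 1; 0, 1] : Matrix (Fin 4) (Fin 2) ℝ) p.1 q.1
      * (1 : Matrix (Fin n) (Fin n) ℝ) p.2 q.2

/-- `Q(x,θ)` (independent of `x`), with block rows `0`, `(b-θ) I`, `0`, `I`. -/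
def Qmat (n : ℕ) (b θ : ℝ) : Matrix (Fin 4 × Fin n) (Fin n) ℝ :=
  Matrix.of fun p j => (![0, b - θ, 0, 1] : Fin 4 → ℝ) p.1 * (1 : Matrix (Fin n) (Fin n) ℝ) p.2 j

/-- `K(x) = (I, (x-a) I)`. -/
def Kmat (n : ℕ) (a x : ℝ) : Matrix (Fin n) (Fin 2 × Fin n) ℝ :=
  Matrix.of fun i q => (![1, x - a] : Fin 2 → ℝ) q.1 * (1 : Matrix (Fin n) (Fin n) ℝ) i q.2

section Operators

variable {n : ℕ} (a b : ℝ) (B : Matrix (Fin 2 × Fin n) (Fin 4 × Fin n) ℝ)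

/-- The kernel `T₂(x,θ) = -K(x) (BH)⁻¹ B Q(x,θ)`. -/
def kerT₂ (x θ : ℝ) : Matrix (Fin n) (Fin n) ℝ :=
  -(Kmat n a x * (B * Hmat n a b)⁻¹ * B * Qmat n b θ)

/-- The kernel `T₁(x,θ) = (x-θ) I + T₂(x,θ)`. -/
def kerT₁ (x θ : ℝ) : Matrix (Fin n) (Fin n) ℝ :=
  (x - θ) • (1 : Matrix (Fin n) (Fin n) ℝ) + kerT₂ a b B x θ

/-- The entrywise partial derivative in `x` of a matrix kernel. -/
def kerDx (T : ℝ → ℝ → Matrix (Fin n) (Fin n) ℝ) (x θ : ℝ) : Matrix (Fin n) (Fin n) ℝ :=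
  Matrix.of fun i j => deriv (fun y => T y θ i j) x

/-- The block column with blocks `M₀, M₁, M₂`. -/
def stack (M₀ M₁ M₂ : Matrix (Fin n) (Fin n) ℝ) : Matrix (Fin 3 × Fin n) (Fin n) ℝ :=
  Matrix.of fun p j => (![M₀, M₁, M₂] p.1) p.2 j

/-- The operator `𝒯₁` on functions on `[a,b]`. -/
def opT₁ (u : ℝ → E n) : ℝ → E n := pi3 a b (fun _ => 0) (kerT₁ a b B) (kerT₂ a b B) u

/-- The operator `(𝒯₂ ψ)(s) = ∫_0^s 𝒯₁ (ψ(θ)) dθ` on functions on `[0,1] × [a,b]`. -/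
def opT₂ (ψ : ℝ × ℝ → E n) (z : ℝ × ℝ) : E n :=
  ∫ θ in (0 : ℝ)..z.1, opT₁ a b B (fun x => ψ (θ, x)) z.2

/-- The operator `(𝒜₂₂ ψ)(s) = -(1/τ) 𝒯₁ (ψ(s))`. -/
def opA₂₂ (τ : ℝ) (ψ : ℝ × ℝ → E n) (z : ℝ × ℝ) : E n :=
  -(1 / τ) • opT₁ a b B (fun x => ψ (z.1, x)) z.2

/-- The operator `𝒜₁₁,d`: the 3-PI operator with parameters `A_d (0, 0, I)` and
`A_d (T_j, ∂ₓT_j, 0)`, `j = 1, 2`. -/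
def opA₁₁d (Ad : ℝ → Matrix (Fin n) (Fin 3 × Fin n) ℝ) (u : ℝ → E n) : ℝ → E n :=
  pi3 a b (fun x => Ad x * stack 0 0 1)
    (fun x θ => Ad x * stack (kerT₁ a b B x θ) (kerDx (kerT₁ a b B) x θ) 0)
    (fun x θ => Ad x * stack (kerT₂ a b B x θ) (kerDx (kerT₂ a b B) x θ) 0) u

/-- The operator `𝒜₁₂ ψ = ∫_0^1 𝒜₁₁,d (ψ(s)) ds`. -/
def opA₁₂ (Ad : ℝ → Matrix (Fin n) (Fin 3 × Fin n) ℝ) (ψ : ℝ × ℝ → E n) (x : ℝ) : E n :=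
  ∫ s in (0 : ℝ)..1, opA₁₁d a b B Ad (fun y => ψ (s, y)) x

end Operators

/-- `A_d(x) (u(x), u_x(x), u_xx(x))` for `u ∈ H₂`. -/
def outAd {n : ℕ} {a b : ℝ} (Ad : ℝ → Matrix (Fin n) (Fin 3 × Fin n) ℝ) (u : H2 n a b) (x : ℝ) :
    E n :=
  WithLp.toLp 2 ((Ad x).mulVec fun p => (H2.d p.1 u x) p.2)

/-! ### Solutions -/

section Solutions

variable {n : ℕ} {a b : ℝ}

/-- `(φ, p)` solves the transport PDE `φ_t = -(1/τ) φ_s`, `φ(t) ∈ Y_{𝒯₁ v(t)}`, with output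
`p(t) = A_d (φ(t,1), φ_x(t,1), φ_xx(t,1))`, initial state `φ₀` and input `v`: up to null sets, `φ`
is a trajectory `Φ` in `H_{(1,2)}`, Fréchet differentiable in `t ≥ 0` for the norm of this space,
that starts at `φ₀` and satisfies the PDE at all times `t ≥ 0`. Values at `t < 0` play no role. -/
def IsPDESol (B : Matrix (Fin 2 × Fin n) (Fin 4 × Fin n) ℝ)
    (Ad : ℝ → Matrix (Fin n) (Fin 3 × Fin n) ℝ) (τ : ℝ) (v : ℝ → L2x n a b)
    (φ : ℝ → ℝ × ℝ → E n) (p : ℝ → L2x n a b) (φ₀ : ℝ × ℝ → E n) : Prop :=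
  ∃ Φ : ℝ → H12 n a b,
    (∀ t, 0 ≤ t → H12.d 0 0 (Φ t) =ᵐ[μ₂ a b] φ t) ∧
    DifferentiableOn ℝ Φ (Ici 0) ∧
    φ 0 =ᵐ[μ₂ a b] φ₀ ∧
    ∀ t, 0 ≤ t →
      Φ t ∈ Y B (opT₁ a b B (v t)) ∧
      H12.d 0 0 (derivWithin Φ (Ici 0) t) = -(1 / τ) • H12.d 1 0 (Φ t) ∧
      ∃ S : ℝ → H2 n a b, IsSlices (Φ t) S ∧ p t =ᵐ[μ₁ a b] outAd Ad (S 1)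

/-- `(ψ, p)` solves the PIE `𝒯₁ v_t + 𝒯₂ ψ_t = 𝒜₂₂ ψ`, `p = 𝒜₁₁,d v + 𝒜₁₂ ψ` with initial state `ψ₀`
and input `v`: the time derivatives of `v` and `ψ` exist as Fréchet derivatives in `L₂`, `ψ` starts
at `ψ₀`, and the equations hold in `L₂` at all times `t ≥ 0`. Values at `t < 0` play no role. -/
def IsPIESol (B : Matrix (Fin 2 × Fin n) (Fin 4 × Fin n) ℝ)
    (Ad : ℝ → Matrix (Fin n) (Fin 3 × Fin n) ℝ) (τ : ℝ) (v : ℝ → L2x n a b)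
    (ψ : ℝ → L2sx n a b) (p : ℝ → L2x n a b) (ψ₀ : L2sx n a b) : Prop :=
  DifferentiableOn ℝ v (Ici 0) ∧ DifferentiableOn ℝ ψ (Ici 0) ∧ ψ 0 = ψ₀ ∧
    ∀ t, 0 ≤ t →
      (∀ᵐ z ∂(μ₂ a b),
        opT₁ a b B (derivWithin v (Ici 0) t : L2x n a b) z.2
            + opT₂ a b B (derivWithin ψ (Ici 0) t : L2sx n a b) z
          = opA₂₂ a b B τ (ψ t) z) ∧
      ∀ᵐ x ∂(μ₁ a b), p t x = opA₁₁d a b B Ad (v t) x + opA₁₂ a b B Ad (ψ t) x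

/-- The function `𝒯₁ v + 𝒯₂ ψ` of `(s, x)`. -/
def recon (B : Matrix (Fin 2 × Fin n) (Fin 4 × Fin n) ℝ) (v : L2x n a b) (ψ : L2sx n a b) :
    ℝ × ℝ → E n :=
  fun z => opT₁ a b B v z.2 + opT₂ a b B ψ z

end Solutions

end DelayPIE

end

noncomputable section

namespace DelayPIE

/-! ### Integral operators on `L₂` -/

section KernelOperators

open scoped NNReal ENNReal

variable {n : ℕ} {Z Θ Ω W : Type*} [MeasurableSpace Z] [MeasurableSpace Θ] [MeasurableSpace Ω]
  [MeasurableSpace W]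

/-! The theorem rests on one bounded linear map, `reconL : (v, ψ) ↦ 𝒯₁ v + 𝒯₂ ψ` from `L₂ × L₂` to
`H_{(1,2)}`, which is a bijection onto the pairs consisting of an input `v` and an element of `Y_{𝒯₁
v}`.

The one-dimensional fact behind it is that `𝒯₁` inverts `∂ₓ²` on `X_B`. Indeed `𝒯₁ u` is the double
primitive of `u` plus an affine function with coefficients `-(BH)⁻¹ B ∫ Q u`, which is precisely the
affine correction that makes the boundary vector `Hc + ∫ Q u` vanish under `B` (`memX_liftH2`).
Conversely an element of `X_B` with zero second derivative is affine, so invertibility of `BH` makes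
it zero (`MemX.eq_zero`).

Since `𝒯₁` acts in `x` only, it commutes with integration in `s`. The slice of `𝒯₁ v + 𝒯₂ ψ` at `s`
is therefore `𝒯₁ (v + ∫_0^s ψ)`; it lies in `X_B`, depends continuously on `s` in `H₂`, and has `∂_s
φ = 𝒯₁ ψ` and `∂_s ∂_x² φ = ψ`. If `φ ∈ Y_0` has `∂_s ∂_x² φ = 0`, then `∂_x² φ(s,·)` is constant in
`s` with initial value zero, so every slice vanishes (`IsSlices.eq_zero`). Hence every `φ ∈ Y_{𝒯₁
v}` is the reconstruction of `v` and `∂_s ∂_x² φ` (`eq_reconL_of_mem_Y`).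

Both `ψ = ∂_s ∂_x² φ` and `v` are bounded linear functions of the reconstructed `φ`
(`inputL_reconL`). So differentiability of `φ` in `H_{(1,2)}` is the same as differentiability of
`v` and `ψ` in `L₂`, and `φ_t` is the reconstruction of `(v_t, ψ_t)`. The transport equation then
reads `𝒯₁ v_t + 𝒯₂ ψ_t = -(1/τ) 𝒯₁ ψ`, and `A_d` applied to the slice at `s = 1` gives the PIE
output (`outAd_reconL`). The second claim is the first with `ψ = ∂_s ∂_x² φ`. -/

lemma eLpNorm_two_sq {μ : Measure W} (f : W → E n) :
    eLpNorm f 2 μ ^ 2 = ∫⁻ x, ‖f x‖ₑ ^ 2 ∂μ := by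
  have := eLpNorm_nnreal_pow_eq_lintegral (f := f) (p := (2 : ℝ≥0)) (μ := μ) (by norm_num)
  simpa using this

/-- Cauchy–Schwarz on a finite measure space. -/
lemma enorm_integral_sq_le {θ : Measure Θ} {f : Θ → E n} (hf : AEStronglyMeasurable f θ) :
    ‖∫ t, f t ∂θ‖ₑ ^ 2 ≤ θ univ * ∫⁻ t, ‖f t‖ₑ ^ 2 ∂θ := by
  have h1 : ‖∫ t, f t ∂θ‖ₑ ≤ eLpNorm f 1 θ := by
    rw [eLpNorm_one_eq_lintegral_enorm]
    exact enorm_integral_le_lintegral_enorm f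
  have h2 := eLpNorm_le_eLpNorm_mul_rpow_measure_univ (p := 1) (q := 2) (by norm_num) hf
  calc ‖∫ t, f t ∂θ‖ₑ ^ 2 ≤ (eLpNorm f 2 θ * θ univ ^ (1 / (1 : ℝ≥0∞).toReal
        - 1 / (2 : ℝ≥0∞).toReal)) ^ 2 := by gcongr; exact h1.trans h2
    _ = θ univ * ∫⁻ t, ‖f t‖ₑ ^ 2 ∂θ := by
        rw [mul_pow, eLpNorm_two_sq, mul_comm, ← ENNReal.rpow_natCast, ← ENNReal.rpow_mul]
        norm_num

variable {ζ : Measure Z} {θ : Measure Θ} [IsFiniteMeasure θ]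

/-- Cauchy–Schwarz in each fibre, then Tonelli. -/
lemma eLpNorm_integral_le {h : Z × Θ → E n} (hh : AEStronglyMeasurable h (ζ.prod θ)) :
    eLpNorm (fun z => ∫ t, h (z, t) ∂θ) 2 ζ
      ≤ ENNReal.ofReal (Real.sqrt (θ.real univ)) * eLpNorm h 2 (ζ.prod θ) := by
  have : eLpNorm (fun z => ∫ t, h (z, t) ∂θ) 2 ζ ^ 2
      ≤ (ENNReal.ofReal (Real.sqrt (θ.real univ)) * eLpNorm h 2 (ζ.prod θ)) ^ 2 := by
    rw [mul_pow, eLpNorm_two_sq, eLpNorm_two_sq, ← ENNReal.ofReal_pow (Real.sqrt_nonneg _),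
      Real.sq_sqrt measureReal_nonneg, ofReal_measureReal,
      lintegral_prod _ (hh.enorm.pow_const 2), ← lintegral_const_mul' _ _ (measure_ne_top _ _)]
    refine lintegral_mono_ae ?_
    filter_upwards [hh.prodMk_left] with z hz
    exact enorm_integral_sq_le hz
  exact (ENNReal.pow_le_pow_left_iff two_ne_zero).1 this

lemma memLp_integral {h : Z × Θ → E n} (hh : MemLp h 2 (ζ.prod θ)) :
    MemLp (fun z => ∫ t, h (z, t) ∂θ) 2 ζ :=
  ⟨hh.1.integral_prod_right', (eLpNorm_integral_le hh.1).trans_lt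
    (ENNReal.mul_lt_top ENNReal.ofReal_lt_top hh.2)⟩

lemma ae_memLp_prodMk {h : Z × Θ → E n} (hh : MemLp h 2 (ζ.prod θ)) :
    ∀ᵐ z ∂ζ, MemLp (fun t => h (z, t)) 2 θ := by
  have h2 : ∫⁻ w, ‖h w‖ₑ ^ 2 ∂(ζ.prod θ) < ⊤ := by
    rw [← eLpNorm_two_sq]; exact ENNReal.pow_lt_top hh.2
  rw [lintegral_prod _ (hh.1.enorm.pow_const 2)] at h2
  filter_upwards [hh.1.prodMk_left, ae_lt_top' (hh.1.enorm.pow_const 2).lintegral_prod_right' h2.ne]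
    with z hz hz2
  refine ⟨hz, ?_⟩
  rw [← eLpNorm_two_sq] at hz2
  by_contra hcon
  rw [not_lt, top_le_iff] at hcon
  rw [hcon] at hz2
  simp at hz2

variable [SFinite ζ]

/-- Integration of the second variable, `L₂(Z × Θ) → L₂(Z)`. -/
def intL (ζ : Measure Z) (θ : Measure Θ) [SFinite ζ] [IsFiniteMeasure θ] :
    Lp (E n) 2 (ζ.prod θ) →L[ℝ] Lp (E n) 2 ζ :=
  LinearMap.mkContinuous
    { toFun := fun h => (memLp_integral (Lp.memLp h)).toLp _
      map_add' := by
        intro f g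
        rw [← MemLp.toLp_add]
        refine MemLp.toLp_congr _ _ ?_
        filter_upwards [ae_memLp_prodMk (Lp.memLp f), ae_memLp_prodMk (Lp.memLp g),
          Measure.ae_ae_of_ae_prod (Lp.coeFn_add f g)] with z hf hg hz
        rw [integral_congr_ae hz, Pi.add_apply]
        exact integral_add (hf.integrable (by norm_num)) (hg.integrable (by norm_num))
      map_smul' := by
        intro c f
        rw [RingHom.id_apply, ← MemLp.toLp_const_smul]
        refine MemLp.toLp_congr _ _ ?_
        filter_upwards [Measure.ae_ae_of_ae_prod (Lp.coeFn_smul c f)] with z hz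
        rw [integral_congr_ae hz, Pi.smul_apply]
        exact integral_smul c _ }
    (Real.sqrt (θ.real univ)) (by
      intro h
      simp only [LinearMap.coe_mk, AddHom.coe_mk]
      rw [Lp.norm_toLp, Lp.norm_def]
      calc _ ≤ (ENNReal.ofReal (Real.sqrt (θ.real univ)) * eLpNorm h 2 (ζ.prod θ)).toReal :=
            ENNReal.toReal_mono (ENNReal.mul_ne_top ENNReal.ofReal_ne_top (Lp.eLpNorm_ne_top h))
              (eLpNorm_integral_le (Lp.aestronglyMeasurable h))
        _ = _ := by rw [ENNReal.toReal_mul, ENNReal.toReal_ofReal (Real.sqrt_nonneg _)])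

lemma intL_ae (h : Lp (E n) 2 (ζ.prod θ)) : intL ζ θ h =ᵐ[ζ] fun z => ∫ t, h (z, t) ∂θ :=
  (memLp_integral (Lp.memLp h)).coeFn_toLp

/-- The data of an operator `g ↦ k · (g ∘ m)` that is bounded from `L₂(ρ)` to `L₂(ξ)`. -/
structure IsPull (ξ : Measure W) (ρ : Measure Ω) (m : W → Ω) (k : W → E n →L[ℝ] E n)
    (c C : ℝ≥0) : Prop where
  meas : Measurable m
  map_le : ξ.map m ≤ c • ρ
  ker_meas : Measurable k
  ker_bound : ∀ᵐ w ∂ξ, ‖k w‖ ≤ C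

namespace IsPull

variable {ξ : Measure W} {ρ : Measure Ω} {m : W → Ω} {k : W → E n →L[ℝ] E n} {c C : ℝ≥0}

lemma quasi (H : IsPull ξ ρ m k c C) : Measure.QuasiMeasurePreserving m ξ ρ :=
  ⟨H.meas, (Measure.absolutelyContinuous_of_le H.map_le).trans (Measure.smul_absolutelyContinuous)⟩

lemma aesm (H : IsPull ξ ρ m k c C) {g : Ω → E n} (hg : AEStronglyMeasurable g ρ) :
    AEStronglyMeasurable (fun w => k w (g (m w))) ξ :=
  (ContinuousLinearMap.apply ℝ (E n)).flip.aestronglyMeasurable_comp₂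
    H.ker_meas.stronglyMeasurable.aestronglyMeasurable (hg.comp_quasiMeasurePreserving H.quasi)

lemma eLpNorm_le (H : IsPull ξ ρ m k c C) {g : Ω → E n} (hg : AEStronglyMeasurable g ρ) :
    eLpNorm (fun w => k w (g (m w))) 2 ξ
      ≤ ENNReal.ofReal (C * Real.sqrt c) * eLpNorm g 2 ρ := by
  have h1 : eLpNorm (fun w => k w (g (m w))) 2 ξ ≤ C • eLpNorm (g ∘ m) 2 ξ := by
    refine eLpNorm_le_nnreal_smul_eLpNorm_of_ae_le_mul ?_ 2
    filter_upwards [H.ker_bound] with w hw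
    exact (k w).le_of_opNorm_le hw _
  -- Change of variables: the norm is taken for the push-forward of `ξ`, which is at most `c • ρ`.
  -- The `L₂` norm turns the factor `c` into its square root.
  have h2 : eLpNorm (g ∘ m) 2 ξ ≤ ENNReal.ofReal (Real.sqrt c) * eLpNorm g 2 ρ := by
    rw [← eLpNorm_map_measure (hg.mono_ac H.quasi.2) H.meas.aemeasurable]
    refine (eLpNorm_mono_measure _ H.map_le).trans ?_
    have := eLpNorm_smul_measure_of_ne_top (p := 2) (by norm_num) g (c : ℝ≥0∞) (μ := ρ)
    refine this.le.trans (le_of_eq ?_)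
    rw [smul_eq_mul]
    congr 1
    rw [Real.sqrt_eq_rpow, ← ENNReal.ofReal_rpow_of_nonneg (NNReal.coe_nonneg c) (by norm_num)]
    simp
  refine h1.trans ?_
  rw [ENNReal.ofReal_mul (NNReal.coe_nonneg C), mul_assoc, ENNReal.ofReal_coe_nnreal,
    ENNReal.smul_def, smul_eq_mul]
  gcongr

lemma memLp (H : IsPull ξ ρ m k c C) {g : Ω → E n} (hg : MemLp g 2 ρ) :
    MemLp (fun w => k w (g (m w))) 2 ξ :=
  ⟨H.aesm hg.1, (H.eLpNorm_le hg.1).trans_lt (ENNReal.mul_lt_top ENNReal.ofReal_lt_top hg.2)⟩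

/-- The operator `g ↦ k · (g ∘ m)` from `L₂(ρ)` to `L₂(ξ)`. -/
def pullL (H : IsPull ξ ρ m k c C) : Lp (E n) 2 ρ →L[ℝ] Lp (E n) 2 ξ :=
  LinearMap.mkContinuous
    { toFun := fun g => (H.memLp (Lp.memLp g)).toLp _
      map_add' := by
        intro f g
        rw [← MemLp.toLp_add]
        refine MemLp.toLp_congr _ _ ?_
        filter_upwards [H.quasi.ae (Lp.coeFn_add f g)] with z hz
        simp only [hz, Pi.add_apply, map_add]
      map_smul' := by
        intro c f
        rw [RingHom.id_apply, ← MemLp.toLp_const_smul]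
        refine MemLp.toLp_congr _ _ ?_
        filter_upwards [H.quasi.ae (Lp.coeFn_smul c f)] with z hz
        simp only [hz, Pi.smul_apply, map_smul] }
    (C * Real.sqrt c) (by
      intro h
      simp only [LinearMap.coe_mk, AddHom.coe_mk]
      rw [Lp.norm_toLp, Lp.norm_def]
      calc _ ≤ (ENNReal.ofReal (C * Real.sqrt c) * eLpNorm h 2 ρ).toReal :=
            ENNReal.toReal_mono (ENNReal.mul_ne_top ENNReal.ofReal_ne_top (Lp.eLpNorm_ne_top h))
              (H.eLpNorm_le (Lp.aestronglyMeasurable h))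
        _ = _ := by rw [ENNReal.toReal_mul, ENNReal.toReal_ofReal (by positivity)])

lemma pullL_ae (H : IsPull ξ ρ m k c C) (g : Lp (E n) 2 ρ) :
    H.pullL g =ᵐ[ξ] fun w => k w (g (m w)) :=
  (H.memLp (Lp.memLp g)).coeFn_toLp

end IsPull

/-- The operator `(K g)(z) = ∫ k(z,t) g(m(z,t)) dθ(t)` from `L₂(ρ)` to `L₂(ζ)`. -/
def kerOp {ρ : Measure Ω} {m : Z × Θ → Ω} {k : Z × Θ → E n →L[ℝ] E n} {c C : ℝ≥0}
    (H : IsPull (ζ.prod θ) ρ m k c C) : Lp (E n) 2 ρ →L[ℝ] Lp (E n) 2 ζ :=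
  (intL ζ θ).comp H.pullL

lemma kerOp_ae {ρ : Measure Ω} {m : Z × Θ → Ω} {k : Z × Θ → E n →L[ℝ] E n} {c C : ℝ≥0}
    (H : IsPull (ζ.prod θ) ρ m k c C) (g : Lp (E n) 2 ρ) :
    kerOp H g =ᵐ[ζ] fun z => ∫ t, k (z, t) (g (m (z, t))) ∂θ := by
  refine (intL_ae _).trans ?_
  filter_upwards [Measure.ae_ae_of_ae_prod (H.pullL_ae g)] with z hz
  exact integral_congr_ae hz

end KernelOperators

/-! ### Calculus on an interval -/

section Interval

variable {F : Type*} [NormedAddCommGroup F] [NormedSpace ℝ F] {a b : ℝ}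

/-- Moving the variable endpoint into the integrand leaves one fixed finite measure, so that
Volterra terms become ordinary kernel operators. -/
lemma primitive_eq {x : ℝ} (hx : x ∈ Icc a b) (f : ℝ → F) :
    ∫ t in a..x, f t = ∫ t, (if t < x then f t else 0) ∂(μ₁ a b) := by
  have h : (fun t => if t < x then f t else 0) = (Iio x).indicator f := by
    ext t; simp [indicator_apply]
  rw [h, setIntegral_indicator measurableSet_Iio, intervalIntegral.integral_of_le hx.1,
    integral_Ioc_eq_integral_Ioo, ← integral_Ico_eq_integral_Ioo]
  congr 2
  ext t
  simp only [mem_Ico, mem_inter_iff, mem_Icc, mem_Iio]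
  exact ⟨fun h => ⟨⟨h.1, h.2.le.trans hx.2⟩, h.2⟩, fun h => ⟨h.1.1, h.2⟩⟩

lemma coprimitive_eq {x : ℝ} (hx : x ∈ Icc a b) (f : ℝ → F) :
    ∫ t in x..b, f t = ∫ t, (if t < x then 0 else f t) ∂(μ₁ a b) := by
  have h : (fun t => if t < x then 0 else f t) = (Ici x).indicator f := by
    ext t; by_cases ht : t < x <;> simp [indicator_apply, ht]
  rw [h, setIntegral_indicator measurableSet_Ici, intervalIntegral.integral_of_le hx.2,
    ← integral_Icc_eq_integral_Ioc]
  congr 2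
  ext t
  simp only [mem_inter_iff, mem_Icc, mem_Ici]
  exact ⟨fun h => ⟨⟨hx.1.trans h.1, h.2⟩, h.1⟩, fun h => ⟨h.2, h.1.2⟩⟩

lemma interval_eq (hab : a ≤ b) (f : ℝ → F) : ∫ t in a..b, f t = ∫ t, f t ∂(μ₁ a b) := by
  rw [intervalIntegral.integral_of_le hab, integral_Icc_eq_integral_Ioc]

lemma dirDeriv_one (η : ℝ → ℝ) : dirDeriv 1 η = deriv η := by
  ext x; rfl

namespace IsTest

variable {η : ℝ → ℝ}

lemma eq_zero {V : Type*} [NormedAddCommGroup V] [NormedSpace ℝ V] {U : Set V} {η : V → ℝ}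
    (h : IsTest U η) {x : V} (hx : x ∉ U) : η x = 0 :=
  image_eq_zero_of_notMem_tsupport fun h' => hx (h.supp h')

lemma integral_deriv (h : IsTest (Ioo a b) η) {x : ℝ} (hx : x ∈ Icc a b) :
    ∫ t, (if t < x then DelayPIE.dirDeriv 1 η t else 0) ∂(μ₁ a b) = η x := by
  have hd : Differentiable ℝ η := h.smooth.differentiable (by simp)
  have hc : Continuous (deriv η) := h.smooth.continuous_deriv (by simp)
  rw [← primitive_eq hx (DelayPIE.dirDeriv 1 η), dirDeriv_one,
    intervalIntegral.integral_deriv_eq_sub (fun t _ => hd t) (hc.intervalIntegrable _ _),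
    h.eq_zero (by simp : a ∉ Ioo a b), sub_zero]

lemma integral_deriv_univ (hab : a ≤ b) (h : IsTest (Ioo a b) η) :
    ∫ t, DelayPIE.dirDeriv 1 η t ∂(μ₁ a b) = 0 := by
  have hd : Differentiable ℝ η := h.smooth.differentiable (by simp)
  have hc : Continuous (deriv η) := h.smooth.continuous_deriv (by simp)
  rw [← interval_eq hab, dirDeriv_one,
    intervalIntegral.integral_deriv_eq_sub (fun t _ => hd t) (hc.intervalIntegrable _ _),
    h.eq_zero (by simp : a ∉ Ioo a b), h.eq_zero (by simp : b ∉ Ioo a b), sub_zero]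

lemma integrable {U : Set ℝ} (h : IsTest U η) : Integrable η (μ₁ a b) :=
  (h.smooth.continuous.integrable_of_hasCompactSupport h.compact).integrableOn

end IsTest

/-- Integration by parts against a test function. -/
lemma integral_dirDeriv_smul [CompleteSpace F] (hab : a ≤ b) {η : ℝ → ℝ}
    (h : IsTest (Ioo a b) η) {f G : ℝ → F}
    {c : F} (hf : Integrable f (μ₁ a b))
    (hG : ∀ᵐ x ∂(μ₁ a b), G x = c + ∫ t, (if t < x then f t else 0) ∂(μ₁ a b)) :
    ∫ x, dirDeriv 1 η x • G x ∂(μ₁ a b) = -∫ x, η x • f x ∂(μ₁ a b) := by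
  have hη' := h.dirDeriv 1
  set η' := dirDeriv 1 η with hη'_def
  have hprod : Integrable (fun z : ℝ × ℝ => η' z.1 • f z.2) ((μ₁ a b).prod (μ₁ a b)) :=
    Integrable.smul_prod (hη'.integrable (a := a) (b := b)) hf
  have hms : MeasurableSet {z : ℝ × ℝ | z.2 < z.1} :=
    measurableSet_lt measurable_snd measurable_fst
  have hprod2 : Integrable (Function.uncurry fun x t => η' x • if t < x then f t else 0)
      ((μ₁ a b).prod (μ₁ a b)) := by
    refine (hprod.indicator hms).congr (Filter.Eventually.of_forall ?_)
    rintro ⟨x, t⟩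
    by_cases ht : t < x <;> simp [Function.uncurry, ht]
  have hcong : (fun x => η' x • G x) =ᵐ[μ₁ a b]
      fun x => η' x • c + ∫ t, η' x • (if t < x then f t else 0) ∂(μ₁ a b) := by
    filter_upwards [hG] with x hx
    rw [hx, smul_add, integral_smul]
  have hint : Integrable (fun x => ∫ t, η' x • (if t < x then f t else 0) ∂(μ₁ a b)) (μ₁ a b) :=
    hprod2.integral_prod_left
  have hi' := hη'.integrable (a := a) (b := b)
  rw [integral_congr_ae hcong, integral_add (hi'.smul_const c) hint, integral_smul_const,
    h.integral_deriv_univ hab, zero_smul, zero_add, integral_integral_swap hprod2, ← integral_neg]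
  refine integral_congr_ae ?_
  filter_upwards [ae_restrict_mem measurableSet_Icc] with t ht
  -- After Fubini the integration over `t < x` is complementary to `x < t` up to the null set `x =
  -- t`. The full integral of `η'` is zero, so only `-η t` remains.
  have h1 : (fun x => η' x • (if t < x then f t else 0))
      = fun x => (η' x - if x < t then η' x else 0) • f t
        - (if x = t then η' x else 0) • f t := by
    ext x
    rcases lt_trichotomy x t with hx | hx | hx
    · simp [hx, hx.not_gt, hx.ne]
    · simp [hx]
    · simp [hx, hx.not_gt, hx.ne']
  have hi2 : Integrable (fun x => if x < t then η' x else 0) (μ₁ a b) := by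
    refine (hi'.indicator measurableSet_Iio (s := Iio t)).congr (Filter.Eventually.of_forall ?_)
    intro x; simp [indicator_apply]
  have h2 : (fun x => η' x • (if t < x then f t else 0)) =ᵐ[μ₁ a b]
      fun x => (η' x - if x < t then η' x else 0) • f t := by
    have : ∀ᵐ x ∂(μ₁ a b), x ≠ t := by
      refine ae_restrict_of_ae ?_
      exact compl_mem_ae_iff.2 (measure_singleton t)
    filter_upwards [this] with x hx
    have := congrFun h1 x
    rw [this]; simp [hx]
  rw [integral_congr_ae h2, integral_smul_const, integral_sub hi' hi2, h.integral_deriv_univ hab,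
    h.integral_deriv ht, zero_sub, neg_smul]

/-! ### Fundamental lemma of the calculus of variations and du Bois-Reymond's lemma. -/

lemma μ₁_ae_mem_Ioo (a b : ℝ) : ∀ᵐ x ∂(μ₁ a b), x ∈ Ioo a b := by
  rw [μ₁, ← restrict_Ioo_eq_restrict_Icc]
  exact ae_restrict_mem measurableSet_Ioo

/-- A function that is orthogonal to all test functions vanishes. -/
lemma ae_eq_zero_of_test [CompleteSpace F] {f : ℝ → F} (hf : Integrable f (μ₁ a b))
    (h : ∀ η, IsTest (Ioo a b) η → ∫ x, η x • f x ∂(μ₁ a b) = 0) : f =ᵐ[μ₁ a b] 0 := by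
  have := IsOpen.ae_eq_zero_of_integral_contDiff_smul_eq_zero (isOpen_Ioo (a := a) (b := b))
    (hf.locallyIntegrable.locallyIntegrableOn _) (fun g h1 h2 h3 => h g ⟨h1, h2, h3⟩)
  filter_upwards [this, μ₁_ae_mem_Ioo a b] with x hx hx2 using hx hx2

lemma exists_test_integral_eq_one (hab : a < b) :
    ∃ η : ℝ → ℝ, IsTest (Ioo a b) η ∧ ∫ x, η x ∂(μ₁ a b) = 1 := by
  -- The closed ball of radius `(b - a) / 4` about the midpoint lies inside `(a, b)`.
  let f : ContDiffBump ((a + b) / 2) := ⟨(b - a) / 8, (b - a) / 4, by linarith, by linarith⟩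
  have hs : tsupport (f.normed volume) ⊆ Ioo a b := by
    rw [f.tsupport_normed_eq, Real.closedBall_eq_Icc]
    intro x hx
    simp only [mem_Icc, f] at hx
    constructor <;> linarith [hx.1, hx.2]
  refine ⟨f.normed volume, ⟨f.contDiff_normed, f.hasCompactSupport_normed, hs⟩, ?_⟩
  rw [← f.integral_normed (μ := volume)]
  exact setIntegral_eq_integral_of_forall_compl_eq_zero fun x hx =>
    image_eq_zero_of_notMem_tsupport fun h => hx (Ioo_subset_Icc_self (hs h))

/-- The primitive from `a` is zero to the left of the support of `β`, and zero to the right of it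
because the total integral vanishes. -/
lemma IsTest.primitive {β : ℝ → ℝ} (hβ : IsTest (Ioo a b) β)
    (h0 : ∫ x, β x ∂(μ₁ a b) = 0) : ∃ η : ℝ → ℝ, IsTest (Ioo a b) η ∧ DelayPIE.dirDeriv 1 η = β := by
  rcases (tsupport β).eq_empty_or_nonempty with he | hne
  · refine ⟨0, ⟨contDiff_const, HasCompactSupport.zero, by simp [tsupport]⟩, ?_⟩
    rw [tsupport_eq_empty_iff] at he
    rw [dirDeriv_one, he]
    ext x; simp
  obtain ⟨l, hl, hl'⟩ := hβ.compact.isCompact.exists_isLeast hne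
  obtain ⟨r, hr, hr'⟩ := hβ.compact.isCompact.exists_isGreatest hne
  have hal := hβ.supp hl
  have hrb := hβ.supp hr
  have hab : a ≤ b := hal.1.le.trans hal.2.le
  have hc := hβ.smooth.continuous
  let P : ℝ → ℝ := fun x => ∫ t in a..x, β t
  have hP : ∀ x, HasDerivAt P (β x) x := fun x =>
    intervalIntegral.integral_hasDerivAt_right (hc.intervalIntegrable _ _)
      (hc.stronglyMeasurableAtFilter _ _) hc.continuousAt
  have hdP : deriv P = β := funext fun x => (hP x).deriv
  have hsm : ContDiff ℝ ∞ P := by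
    rw [contDiff_infty_iff_deriv]
    exact ⟨fun x => (hP x).differentiableAt, by rw [hdP]; exact hβ.smooth⟩
  have hz : ∀ x, x ∉ Icc l r → β x = 0 := fun x hx =>
    image_eq_zero_of_notMem_tsupport fun h => hx ⟨hl' h, hr' h⟩
  have hPz : ∀ x, x ∉ Icc l r → P x = 0 := by
    intro x hx
    rw [mem_Icc, not_and_or, not_le, not_le] at hx
    rcases hx with hx | hx
    · refine (intervalIntegral.integral_congr (g := fun _ => 0) fun t ht => hz t fun h => ?_).trans
        (by simp)
      have := ht.2
      have := h.1
      linarith [max_lt hal.1 hx]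
    · have h1 : P b = 0 := by
        simp only [P]; rw [interval_eq hab, h0]
      have h2 : P b - P x = ∫ t in x..b, β t := by
        simp only [P]
        rw [intervalIntegral.integral_interval_sub_left (hc.intervalIntegrable _ _)
          (hc.intervalIntegrable _ _)]
      have h3 : ∫ t in x..b, β t = 0 := by
        refine (intervalIntegral.integral_congr (g := fun _ => 0) fun t ht => hz t fun h => ?_).trans
          (by simp)
        have := ht.1
        have := h.2
        linarith [lt_min hx hrb.2]
      linarith
  have hts : tsupport P ⊆ Icc l r :=
    closure_minimal (fun x hx => by_contra fun h => hx (hPz x h)) isClosed_Icc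
  refine ⟨P, ⟨hsm, HasCompactSupport.of_support_subset_isCompact isCompact_Icc
    (subset_closure.trans hts), hts.trans fun x hx => ⟨hal.1.trans_le hx.1, hx.2.trans_lt hrb.2⟩⟩, ?_⟩
  rw [dirDeriv_one, hdP]

lemma IsTest.sub_const_mul {V : Type*} [NormedAddCommGroup V] [NormedSpace ℝ V] {U : Set V}
    {η ξ : V → ℝ} (hη : IsTest U η) (hξ : IsTest U ξ) (c : ℝ) :
    IsTest U (fun x => η x - c * ξ x) where
  smooth := hη.smooth.sub (contDiff_const.mul hξ.smooth)
  compact := hη.compact.sub (hξ.compact.mul_left (f := fun _ => c))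
  supp := (tsupport_sub _ _).trans
    (union_subset hη.supp ((tsupport_mul_subset_right (f := fun _ => c)).trans hξ.supp))

/-- A continuous function with vanishing weak derivative is constant. -/
lemma eqOn_const_of_weak_deriv_zero [CompleteSpace F] (hab : a < b) {f : ℝ → F}
    (hf : ContinuousOn f (Icc a b))
    (h : ∀ η, IsTest (Ioo a b) η → ∫ x, dirDeriv 1 η x • f x ∂(μ₁ a b) = 0) :
    ∀ x ∈ Icc a b, f x = f a := by
  obtain ⟨α, hα, hα1⟩ := exists_test_integral_eq_one hab
  have hfi : Integrable f (μ₁ a b) := hf.integrableOn_compact isCompact_Icc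
  have hsm : ∀ {η : ℝ → ℝ} {g : ℝ → F}, IsTest (Ioo a b) η → Integrable g (μ₁ a b) →
      Integrable (fun x => η x • g x) (μ₁ a b) := fun hη hg =>
    hg.locallyIntegrable.integrable_smul_left_of_hasCompactSupport hη.smooth.continuous hη.compact
  set c := ∫ x, α x • f x ∂(μ₁ a b) with hc
  have h0 : (fun x => f x - c) =ᵐ[μ₁ a b] 0 := by
    refine ae_eq_zero_of_test (hfi.sub (integrable_const c)) fun η hη => ?_
    have hi := hη.integrable (a := a) (b := b)
    have hj := hα.integrable (a := a) (b := b)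
    -- `η` minus its integral times `α` has mean zero, hence is the derivative of a test function
    -- `ξ`. Testing with `ξ` replaces `∫ η f` by `(∫ η) c`.
    obtain ⟨ξ, hξ, hξ'⟩ := (hη.sub_const_mul hα (∫ x, η x ∂(μ₁ a b))).primitive (by
      rw [integral_sub hi (hj.const_mul _), integral_const_mul, hα1, mul_one, sub_self])
    have := h ξ hξ
    simp only [hξ', sub_smul, mul_smul] at this
    rw [integral_sub (hsm hη hfi) (by exact (hsm hα hfi).smul (∫ x, η x ∂(μ₁ a b))), integral_smul,
      ← hc] at this
    simp only [smul_sub]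
    rw [integral_sub (hsm hη hfi) (hi.smul_const c), integral_smul_const, this]
  -- Continuity upgrades almost-everywhere equality to equality on the closed interval, endpoints
  -- included.
  have h1 := Measure.eqOn_Icc_of_ae_eq volume hab.ne (g := fun _ => c)
    (h0.mono fun x hx => sub_eq_zero.1 hx) hf continuousOn_const
  intro x hx
  rw [h1 hx, h1 (left_mem_Icc.2 hab.le)]

end Interval

/-! ### Kernels -/

section Kernels

open scoped NNReal

variable {n : ℕ} {a b : ℝ}

/-- A matrix acting on `ℝⁿ` as a continuous linear map. -/
def actL {n : ℕ} : Matrix (Fin n) (Fin n) ℝ →ₗ[ℝ] (E n →L[ℝ] E n) :=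
  (Matrix.toEuclideanCLM (n := Fin n) (𝕜 := ℝ)).toAlgEquiv.toLinearMap

lemma actL_apply (M : Matrix (Fin n) (Fin n) ℝ) (u : E n) : actL M u = act M u := rfl

lemma continuous_actL : Continuous (actL (n := n)) :=
  LinearMap.continuous_of_finiteDimensional _

/-- The kernel `k` is measurable, and bounded by `C` on `[a,b]²`. -/
structure IsKer (a b : ℝ) (k : ℝ → ℝ → E n →L[ℝ] E n) (C : ℝ≥0) : Prop where
  meas : Measurable (Function.uncurry k)
  bound : ∀ x ∈ Icc a b, ∀ t ∈ Icc a b, ‖k x t‖ ≤ C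

/-- The operator `u ↦ ∫_a^b k(x,t) u(t) dt` on functions. -/
def fOp (a b : ℝ) (k : ℝ → ℝ → E n →L[ℝ] E n) (u : ℝ → E n) (x : ℝ) : E n :=
  ∫ t, k x t (u t) ∂(μ₁ a b)

lemma IsKer.integrable {k : ℝ → ℝ → E n →L[ℝ] E n} {C : ℝ≥0} (hk : IsKer a b k C) {x : ℝ}
    (hx : x ∈ Icc a b) {u : ℝ → E n} (hu : Integrable u (μ₁ a b)) :
    Integrable (fun t => k x t (u t)) (μ₁ a b) := by
  refine (hu.norm.const_mul (C : ℝ)).mono' ?_ ?_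
  · exact (ContinuousLinearMap.apply ℝ (E n)).flip.aestronglyMeasurable_comp₂
      (hk.meas.of_uncurry_left (x := x)).stronglyMeasurable.aestronglyMeasurable hu.1
  · filter_upwards [ae_restrict_mem measurableSet_Icc] with t ht
    exact (k x t).le_of_opNorm_le (hk.bound x hx t ht) _

/-- Each branch is bounded on the compact square; the jump across the diagonal costs neither
measurability nor the bound. -/
lemma IsKer.of_continuous {k₁ k₂ : ℝ → ℝ → E n →L[ℝ] E n}
    (h₁ : Continuous (Function.uncurry k₁)) (h₂ : Continuous (Function.uncurry k₂)) :
    ∃ C, IsKer a b (fun x t => if t < x then k₁ x t else k₂ x t) C := by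
  have hK : IsCompact (Icc a b ×ˢ Icc a b) := isCompact_Icc.prod isCompact_Icc
  obtain ⟨C₁, hC₁⟩ := hK.exists_bound_of_continuousOn h₁.continuousOn
  obtain ⟨C₂, hC₂⟩ := hK.exists_bound_of_continuousOn h₂.continuousOn
  refine ⟨(max C₁ C₂).toNNReal, ?_, ?_⟩
  · exact Measurable.ite (measurableSet_lt measurable_snd measurable_fst) h₁.measurable
      h₂.measurable
  · intro x hx t ht
    refine le_trans ?_ (Real.le_coe_toNNReal _)
    split_ifs
    · exact (hC₁ (x, t) ⟨hx, ht⟩).trans (le_max_left _ _)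
    · exact (hC₂ (x, t) ⟨hx, ht⟩).trans (le_max_right _ _)

lemma integral_split {F : Type*} [NormedAddCommGroup F] [NormedSpace ℝ F] {x : ℝ}
    (hx : x ∈ Icc a b) (f g : ℝ → F)
    (h : Integrable (fun t => if t < x then f t else g t) (μ₁ a b)) :
    (∫ t in a..x, f t) + ∫ t in x..b, g t = ∫ t, (if t < x then f t else g t) ∂(μ₁ a b) := by
  rw [primitive_eq hx, coprimitive_eq hx, ← integral_add]
  · refine integral_congr_ae (Filter.Eventually.of_forall fun t => ?_)
    dsimp only
    split_ifs <;> simp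
  · refine (h.indicator measurableSet_Iio (s := Iio x)).congr (Filter.Eventually.of_forall ?_)
    intro t; by_cases ht : t < x <;> simp [ht]
  · refine (h.indicator measurableSet_Ici (s := Ici x)).congr (Filter.Eventually.of_forall ?_)
    intro t; by_cases ht : t < x <;> simp [indicator_apply, ht]

variable (a b) (B : Matrix (Fin 2 × Fin n) (Fin 4 × Fin n) ℝ)

/-! ### The kernels as affine functions of `x`. -/

/-- The coefficients `C₀, C₁` of `T₂(x,θ) = C₀(θ) + (x-a) C₁(θ)`. -/
def coef (i : Fin 2) (θ : ℝ) : Matrix (Fin n) (Fin n) ℝ :=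
  Matrix.of fun p q => -((B * Hmat n a b)⁻¹ * B * Qmat n b θ) (i, p) q

/-- `K(x)` is the only factor that depends on `x`, and it is affine. The `x`-derivatives of both
kernels can then be read off. -/
lemma kerT₂_eq (x θ : ℝ) : kerT₂ a b B x θ = coef a b B 0 θ + (x - a) • coef a b B 1 θ := by
  ext i j
  have : kerT₂ a b B x θ = -(Kmat n a x * ((B * Hmat n a b)⁻¹ * B * Qmat n b θ)) := by
    simp only [kerT₂, Matrix.mul_assoc]
  rw [this, Matrix.neg_apply, Matrix.mul_apply, Fintype.sum_prod_type, Fin.sum_univ_two]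
  simp [coef, Kmat, Matrix.one_apply]
  ring

lemma continuous_coef (i : Fin 2) : Continuous (coef a b B i) := by
  have hQ : Continuous (fun θ => Qmat n b θ) := by
    refine continuous_matrix fun p j => ?_
    simp only [Qmat, Matrix.of_apply]
    refine Continuous.mul ?_ continuous_const
    obtain ⟨p, q⟩ := p
    fin_cases p <;> simp <;> fun_prop
  refine continuous_matrix fun p q => ?_
  simp only [coef, Matrix.of_apply]
  exact ((continuous_const.matrix_mul hQ).matrix_elem (i, p) q).neg

lemma kerDx_kerT₂ (x θ : ℝ) : kerDx (kerT₂ a b B) x θ = coef a b B 1 θ := by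
  ext i j
  have : (fun y => kerT₂ a b B y θ i j)
      = fun y => coef a b B 0 θ i j + (y - a) * coef a b B 1 θ i j := by
    ext y; rw [kerT₂_eq]; simp
  rw [kerDx, Matrix.of_apply, this]
  simp

lemma kerDx_kerT₁ (x θ : ℝ) : kerDx (kerT₁ a b B) x θ = 1 + coef a b B 1 θ := by
  ext i j
  have : (fun y => kerT₁ a b B y θ i j)
      = fun y => (y - θ) * (1 : Matrix (Fin n) (Fin n) ℝ) i j
        + (coef a b B 0 θ i j + (y - a) * coef a b B 1 θ i j) := by
    ext y; rw [kerT₁, kerT₂_eq]; simp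
  rw [kerDx, Matrix.of_apply, this]
  rw [deriv_fun_add (by fun_prop) (by fun_prop)]
  simp

/-- The kernel of `𝒯₁`. -/
def ker₀ (x t : ℝ) : E n →L[ℝ] E n :=
  if t < x then actL (kerT₁ a b B x t) else actL (kerT₂ a b B x t)

/-- The kernel of `∂ₓ𝒯₁`. -/
def ker₁ (x t : ℝ) : E n →L[ℝ] E n :=
  if t < x then actL (kerDx (kerT₁ a b B) x t) else actL (kerDx (kerT₂ a b B) x t)

lemma exists_isKer₀ : ∃ C, IsKer a b (ker₀ a b B) C := by
  have h1 : Continuous (Function.uncurry (kerT₂ a b B)) := by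
    have : Function.uncurry (kerT₂ a b B)
        = fun z => coef a b B 0 z.2 + (z.1 - a) • coef a b B 1 z.2 := by
      ext z : 1; exact kerT₂_eq a b B z.1 z.2
    rw [this]
    have := continuous_coef a b B 0
    have := continuous_coef a b B 1
    fun_prop
  have h2 : Continuous (Function.uncurry (kerT₁ a b B)) := by
    have : Function.uncurry (kerT₁ a b B)
        = fun z => (z.1 - z.2) • 1 + Function.uncurry (kerT₂ a b B) z := rfl
    rw [this]
    fun_prop
  exact IsKer.of_continuous (continuous_actL.comp h2) (continuous_actL.comp h1)

lemma exists_isKer₁ : ∃ C, IsKer a b (ker₁ a b B) C := by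
  have hc := continuous_coef a b B 1
  refine IsKer.of_continuous (continuous_actL.comp ?_) (continuous_actL.comp ?_)
  · simp only [kerDx_kerT₁]; fun_prop
  · simp only [kerDx_kerT₂]; fun_prop

/-- The function `∂ₓʲ 𝒯₁ u`. -/
def fT (j : Fin 3) (u : ℝ → E n) (x : ℝ) : E n :=
  ![fOp a b (ker₀ a b B) u x, fOp a b (ker₁ a b B) u x, u x] j

variable {a b}

lemma opT₁_eq {x : ℝ} (hx : x ∈ Icc a b) {u : ℝ → E n} (hu : Integrable u (μ₁ a b)) :
    opT₁ a b B u x = fOp a b (ker₀ a b B) u x := by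
  obtain ⟨C, hC⟩ := exists_isKer₀ a b B
  have h := hC.integrable hx hu
  have h2 : (fun t => ker₀ a b B x t (u t))
      = fun t => if t < x then act (kerT₁ a b B x t) (u t) else act (kerT₂ a b B x t) (u t) := by
    ext1 t
    by_cases ht : t < x <;> simp [ker₀, ht, actL_apply]
  rw [h2] at h
  rw [fOp, h2, ← integral_split hx _ _ h, opT₁, pi3, ← actL_apply 0]
  simp

/-- The block `A_j` of `A = (A₀, A₁, A₂)`. -/
def blk (A : Matrix (Fin n) (Fin 3 × Fin n) ℝ) (j : Fin 3) : E n →L[ℝ] E n :=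
  actL (A.submatrix id fun q => (j, q))

lemma toLp_mulVec_eq (A : Matrix (Fin n) (Fin 3 × Fin n) ℝ) (w : Fin 3 → E n) :
    WithLp.toLp 2 (A.mulVec fun p => w p.1 p.2) = ∑ j, blk A j (w j) := by
  ext i
  simp [Matrix.mulVec, dotProduct, Fintype.sum_prod_type, blk, actL_apply, act]

lemma act_mul_stack (A : Matrix (Fin n) (Fin 3 × Fin n) ℝ) (M₀ M₁ M₂ : Matrix (Fin n) (Fin n) ℝ)
    (u : E n) : act (A * stack M₀ M₁ M₂) u
      = blk A 0 (actL M₀ u) + blk A 1 (actL M₁ u) + blk A 2 (actL M₂ u) := by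
  have := toLp_mulVec_eq A ![actL M₀ u, actL M₁ u, actL M₂ u]
  rw [Fin.sum_univ_three] at this
  refine Eq.trans ?_ this
  rw [act, ← Matrix.mulVec_mulVec]
  congr 2
  ext ⟨p, q⟩
  fin_cases p <;> rfl

lemma outAd_eq (Ad : ℝ → Matrix (Fin n) (Fin 3 × Fin n) ℝ) (u : H2 n a b) (x : ℝ) :
    outAd Ad u x = ∑ j, blk (Ad x) j (H2.d j u x) :=
  toLp_mulVec_eq (Ad x) fun j => H2.d j u x

/-- `Ad x` does not depend on the integration variable, so its blocks come out of the integral and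
act on `∂ₓʲ 𝒯₁ u`. The multiplier part supplies the term `j = 2`, where `∂ₓ² 𝒯₁ u` is `u` itself. -/
lemma opA₁₁d_eq (Ad : ℝ → Matrix (Fin n) (Fin 3 × Fin n) ℝ) {x : ℝ} (hx : x ∈ Icc a b)
    {u : ℝ → E n} (hu : Integrable u (μ₁ a b)) :
    opA₁₁d a b B Ad u x = ∑ j, blk (Ad x) j (fT a b B j u x) := by
  obtain ⟨C₀, hC₀⟩ := exists_isKer₀ a b B
  obtain ⟨C₁, hC₁⟩ := exists_isKer₁ a b B
  have h₀ := (blk (Ad x) 0).integrable_comp (hC₀.integrable hx hu)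
  have h₁ := (blk (Ad x) 1).integrable_comp (hC₁.integrable hx hu)
  have h := h₀.add h₁
  have h2 : ((fun t => blk (Ad x) 0 (ker₀ a b B x t (u t)))
        + fun t => blk (Ad x) 1 (ker₁ a b B x t (u t)))
      = fun t => if t < x then
          act (Ad x * stack (kerT₁ a b B x t) (kerDx (kerT₁ a b B) x t) 0) (u t)
        else act (Ad x * stack (kerT₂ a b B x t) (kerDx (kerT₂ a b B) x t) 0) (u t) := by
    ext1 t
    simp only [act_mul_stack, Pi.add_apply, map_zero, zero_apply, add_zero]
    by_cases ht : t < x <;> simp [ker₀, ker₁, ht]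
  rw [h2] at h
  rw [opA₁₁d, pi3, add_assoc, integral_split hx _ _ h, ← h2]
  rw [integral_add' h₀ h₁, (blk (Ad x) 0).integral_comp_comm (hC₀.integrable hx hu),
    (blk (Ad x) 1).integral_comp_comm (hC₁.integrable hx hu), Fin.sum_univ_three]
  refine (congrArg (· + _) (act_mul_stack (Ad x) 0 0 1 (u x))).trans ?_
  have : actL (1 : Matrix (Fin n) (Fin n) ℝ) (u x) = u x := by
    simp [actL_apply, act]
  simp only [map_zero, zero_apply, zero_add, this]
  rw [add_comm]
  rfl

/-! ### `𝒯₁ u` as an affine function plus a double primitive. -/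

/-- The coefficients `c₀, c₁` of the affine part of `𝒯₁ u`. -/
def affine (B : Matrix (Fin 2 × Fin n) (Fin 4 × Fin n) ℝ) (a b : ℝ) (i : Fin 2) (u : ℝ → E n) :
    E n :=
  ∫ t, actL (coef a b B i t) (u t) ∂(μ₁ a b)

lemma integrable_coef (i : Fin 2) {u : ℝ → E n} (hu : Integrable u (μ₁ a b)) :
    Integrable (fun t => actL (coef a b B i t) (u t)) (μ₁ a b) := by
  -- The coefficient is treated as a kernel constant in `x`, which needs some point `x` of the
  -- interval; on an empty interval the measure is zero.
  rcases isEmpty_or_nonempty (Icc a b) with he | ⟨⟨x, hx⟩⟩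
  · rw [isEmpty_coe_sort] at he
    simp [μ₁, he]
  have hc : Continuous (Function.uncurry fun (_ : ℝ) t => actL (coef a b B i t)) :=
    continuous_actL.comp ((continuous_coef a b B i).comp continuous_snd)
  obtain ⟨C, hC⟩ := IsKer.of_continuous (a := a) (b := b)
    (k₁ := fun _ t => actL (coef a b B i t)) (k₂ := fun _ t => actL (coef a b B i t)) hc hc
  simpa using hC.integrable hx hu

/-- The differentiated kernels are `I + C₁(t)` for `t < x` and `C₁(t)` otherwise; the common part
integrates to a constant. -/
lemma fOp_ker₁_eq {x : ℝ} {u : ℝ → E n} (hu : Integrable u (μ₁ a b)) :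
    fOp a b (ker₁ a b B) u x
      = affine B a b 1 u + ∫ t, (if t < x then u t else 0) ∂(μ₁ a b) := by
  have hi : Integrable (fun t => if t < x then u t else 0) (μ₁ a b) := by
    refine (hu.indicator measurableSet_Iio (s := Iio x)).congr (Filter.Eventually.of_forall ?_)
    intro t; simp [indicator_apply]
  rw [affine, ← integral_add (integrable_coef B 1 hu) hi, fOp]
  congr 1
  ext1 t
  by_cases ht : t < x
  · simp [ker₁, ht, kerDx_kerT₁, map_add]
    simp [actL_apply, act, add_comm]
  · simp [ker₁, ht, kerDx_kerT₂]

lemma fOp_ker₀_eq {x : ℝ} {u : ℝ → E n} (hu : Integrable u (μ₁ a b)) :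
    fOp a b (ker₀ a b B) u x = affine B a b 0 u + (x - a) • affine B a b 1 u
      + ∫ t, (if t < x then (x - t) • u t else 0) ∂(μ₁ a b) := by
  have hu' : Integrable (fun t => (x - t) • u t) (μ₁ a b) :=
    IntegrableOn.continuousOn_smul hu (by fun_prop) isCompact_Icc
  have hi : Integrable (fun t => if t < x then (x - t) • u t else 0) (μ₁ a b) := by
    refine (hu'.indicator measurableSet_Iio (s := Iio x)).congr (Filter.Eventually.of_forall ?_)
    intro t; simp [indicator_apply]
  have h1 := integrable_coef B 1 hu
  have h0 := integrable_coef B 0 hu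
  rw [affine, affine, ← integral_smul, ← integral_add h0 (by exact h1.smul (x - a)),
    ← integral_add (by exact h0.add (h1.smul (x - a))) hi, fOp]
  congr 1
  ext1 t
  by_cases ht : t < x
  · simp [ker₀, ht, kerT₁, kerT₂_eq, map_add]
    simp [actL_apply, act, add_comm]
  · simp [ker₀, ht, kerT₂_eq]

/-- Cauchy's formula for repeated integration: by Fubini `u t` is weighted by the length of `{y | t
< y < x}`, which is the positive part of `x - t`. -/
lemma integral_ite_integral_ite {x : ℝ} (hx : x ∈ Icc a b) {u : ℝ → E n}
    (hu : Integrable u (μ₁ a b)) :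
    ∫ y, (if y < x then ∫ t, (if t < y then u t else 0) ∂(μ₁ a b) else 0) ∂(μ₁ a b)
      = ∫ t, (if t < x then (x - t) • u t else 0) ∂(μ₁ a b) := by
  have h1 : ∀ y, (if y < x then ∫ t, (if t < y then u t else 0) ∂(μ₁ a b) else 0)
      = ∫ t, (if t < y ∧ y < x then (1 : ℝ) else 0) • u t ∂(μ₁ a b) := by
    intro y
    by_cases hy : y < x <;> simp [hy]
  have hp : Integrable (fun z : ℝ × ℝ => (1 : ℝ) • u z.2) ((μ₁ a b).prod (μ₁ a b)) :=
    Integrable.smul_prod (integrable_const (1 : ℝ)) hu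
  have hms : MeasurableSet {z : ℝ × ℝ | z.2 < z.1 ∧ z.1 < x} :=
    (measurableSet_lt measurable_snd measurable_fst).inter
      (measurableSet_lt measurable_fst measurable_const)
  have hp2 : Integrable (Function.uncurry fun y t =>
      (if t < y ∧ y < x then (1 : ℝ) else 0) • u t) ((μ₁ a b).prod (μ₁ a b)) := by
    refine (hp.indicator hms).congr (Filter.Eventually.of_forall ?_)
    rintro ⟨y, t⟩
    by_cases ht : t < y ∧ y < x <;> simp [Function.uncurry, ht]
  simp_rw [h1]
  rw [integral_integral_swap hp2]
  refine integral_congr_ae ?_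
  filter_upwards [ae_restrict_mem measurableSet_Icc] with t ht
  rw [integral_smul_const]
  have h2 : ∫ y, (if t < y ∧ y < x then (1 : ℝ) else 0) ∂(μ₁ a b) = max (x - t) 0 := by
    have : (fun y => if t < y ∧ y < x then (1 : ℝ) else 0) = (Ioo t x).indicator 1 := by
      ext y; simp [indicator_apply]
    rw [this, integral_indicator_one measurableSet_Ioo, measureReal_restrict_apply
      measurableSet_Ioo, inter_eq_left.2, Real.volume_real_Ioo]
    exact fun y hy => ⟨ht.1.trans hy.1.le, hy.2.le.trans hx.2⟩
  rw [h2]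
  by_cases htx : t < x
  · simp [htx, htx.le]
  · simp [htx, not_lt.1 htx]

/-- At the left endpoint the primitive vanishes, so the affine coefficients are the boundary values
of `𝒯₁ u` and its derivative at `a`. -/
lemma affine_zero_eq {u : ℝ → E n} (hu : Integrable u (μ₁ a b)) :
    fOp a b (ker₀ a b B) u a = affine B a b 0 u := by
  rw [fOp_ker₀_eq B hu, sub_self, zero_smul, add_zero]
  have : (fun t => if t < a then (a - t) • u t else 0) =ᵐ[μ₁ a b] 0 := by
    filter_upwards [ae_restrict_mem measurableSet_Icc] with t ht
    simp [ht.1.not_gt]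
  rw [integral_congr_ae this]; simp

lemma affine_one_eq {u : ℝ → E n} (hu : Integrable u (μ₁ a b)) :
    fOp a b (ker₁ a b B) u a = affine B a b 1 u := by
  rw [fOp_ker₁_eq B hu]
  have : (fun t => if t < a then u t else 0) =ᵐ[μ₁ a b] 0 := by
    filter_upwards [ae_restrict_mem measurableSet_Icc] with t ht
    simp [ht.1.not_gt]
  rw [integral_congr_ae this]; simp

lemma continuousOn_primitive_ite {u : ℝ → E n} (hu : Integrable u (μ₁ a b)) :
    ContinuousOn (fun x => ∫ t, (if t < x then u t else 0) ∂(μ₁ a b)) (Icc a b) := by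
  refine (intervalIntegral.continuousOn_primitive (f := u) (a := a) (b := b) hu).congr ?_
  intro x hx
  dsimp only
  rw [← primitive_eq hx, intervalIntegral.integral_of_le hx.1]

lemma continuousOn_fOp_ker₁ {u : ℝ → E n} (hu : Integrable u (μ₁ a b)) :
    ContinuousOn (fOp a b (ker₁ a b B) u) (Icc a b) :=
  (continuousOn_const.add (continuousOn_primitive_ite hu)).congr fun _ _ => fOp_ker₁_eq B hu

/-- This is the form that integration by parts against test functions requires; it also yields
continuity of `𝒯₁ u` up to the boundary. -/
lemma fOp_ker₀_primitive {u : ℝ → E n} (hu : Integrable u (μ₁ a b)) {x : ℝ} (hx : x ∈ Icc a b) :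
    fOp a b (ker₀ a b B) u x = affine B a b 0 u
      + ∫ y, (if y < x then fOp a b (ker₁ a b B) u y else 0) ∂(μ₁ a b) := by
  have hi : Integrable (fun y => if y < x then affine B a b 1 u else 0) (μ₁ a b) := by
    refine ((integrable_const (affine B a b 1 u)).indicator measurableSet_Iio (s := Iio x)).congr
      (Filter.Eventually.of_forall ?_)
    intro t; simp [indicator_apply]
  have hp : Integrable (fun y => ∫ t, (if t < y then u t else 0) ∂(μ₁ a b)) (μ₁ a b) :=
    (continuousOn_primitive_ite hu).integrableOn_compact isCompact_Icc
  have hi2 : Integrable (fun y => if y < x then ∫ t, (if t < y then u t else 0) ∂(μ₁ a b) else 0)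
      (μ₁ a b) := by
    refine (hp.indicator measurableSet_Iio (s := Iio x)).congr (Filter.Eventually.of_forall ?_)
    intro t; simp [indicator_apply]
  have h : (fun y => if y < x then fOp a b (ker₁ a b B) u y else 0)
      = fun y => (if y < x then affine B a b 1 u else 0)
        + if y < x then ∫ t, (if t < y then u t else 0) ∂(μ₁ a b) else 0 := by
    ext1 y
    rw [fOp_ker₁_eq B hu]
    split_ifs <;> simp
  rw [h, integral_add hi hi2, integral_ite_integral_ite hx hu, fOp_ker₀_eq B hu,
    ← primitive_eq hx (fun _ => affine B a b 1 u)]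
  simp [add_assoc]

lemma continuousOn_fOp_ker₀ {u : ℝ → E n} (hu : Integrable u (μ₁ a b)) :
    ContinuousOn (fOp a b (ker₀ a b B) u) (Icc a b) :=
  (continuousOn_const.add (continuousOn_primitive_ite
    ((continuousOn_fOp_ker₁ B hu).integrableOn_compact isCompact_Icc))).congr
    fun _ hx => fOp_ker₀_primitive B hu hx

end Kernels

/-! ### The operators on `L₂` -/

section LpOperators

open scoped NNReal ENNReal

variable {n : ℕ} {a b : ℝ}

lemma μ₂_eq (a b : ℝ) : μ₂ a b = (μ₁ 0 1).prod (μ₁ a b) := by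
  rw [μ₁, μ₁, Measure.prod_restrict]; rfl

lemma ae_ae_of_ae_μ₂ {p : ℝ × ℝ → Prop} (h : ∀ᵐ z ∂(μ₂ a b), p z) :
    ∀ᵐ s ∂(μ₁ 0 1), ∀ᵐ x ∂(μ₁ a b), p (s, x) := by
  rw [μ₂_eq] at h
  exact Measure.ae_ae_of_ae_prod h

lemma ae_ae_swap_of_ae_μ₂ {p : ℝ × ℝ → Prop} (h : ∀ᵐ z ∂(μ₂ a b), p z) :
    ∀ᵐ x ∂(μ₁ a b), ∀ᵐ s ∂(μ₁ 0 1), p (s, x) := by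
  rw [μ₂_eq] at h
  exact Measure.ae_ae_of_ae_prod (p := fun w : ℝ × ℝ => p w.swap)
    (Measure.measurePreserving_swap.quasiMeasurePreserving.ae h)

lemma ae_snd_of_ae {p : ℝ → Prop} (h : ∀ᵐ x ∂(μ₁ a b), p x) :
    ∀ᵐ z ∂(μ₂ a b), p z.2 := by
  rw [μ₂_eq]
  exact Measure.quasiMeasurePreserving_snd.ae h

lemma ae_fst_of_ae {p : ℝ → Prop} (h : ∀ᵐ x ∂(μ₁ 0 1), p x) :
    ∀ᵐ z ∂(μ₂ a b), p z.1 := by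
  rw [μ₂_eq]
  exact Measure.quasiMeasurePreserving_fst.ae h

lemma μ₁_univ (a b : ℝ) : μ₁ a b univ = ((b - a).toNNReal : ℝ≥0∞) := by
  rw [Measure.restrict_apply_univ, Real.volume_Icc]; rfl

lemma μ₁_unit_univ : μ₁ 0 1 univ = 1 := by
  rw [μ₁_univ]; simp

lemma integrable_L2x (u : L2x n a b) : Integrable u (μ₁ a b) :=
  (Lp.memLp u).integrable (by norm_num)

lemma integrable_L2sx (ψ : L2sx n a b) : Integrable ψ (μ₂ a b) :=
  (Lp.memLp ψ).integrable (by norm_num)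

lemma integrable_prod_L2sx (ψ : L2sx n a b) : Integrable ψ ((μ₁ 0 1).prod (μ₁ a b)) := by
  rw [← μ₂_eq]; exact integrable_L2sx ψ

lemma ae_memLp_L2sx (ψ : L2sx n a b) :
    ∀ᵐ s ∂(μ₁ 0 1), MemLp (fun x => ψ (s, x)) 2 (μ₁ a b) := by
  have h : MemLp ψ 2 ((μ₁ 0 1).prod (μ₁ a b)) := by rw [← μ₂_eq]; exact Lp.memLp ψ
  exact ae_memLp_prodMk h

lemma map_snd_μ₂ (a b : ℝ) : (μ₂ a b).map Prod.snd = μ₁ a b := by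
  rw [μ₂_eq, Measure.map_snd_prod, μ₁_unit_univ, one_smul]

variable {k : ℝ → ℝ → E n →L[ℝ] E n} {C : ℝ≥0}

lemma IsKer.ae_bound (hk : IsKer a b k C) :
    ∀ᵐ w ∂((μ₁ a b).prod (μ₁ a b)), ‖k w.1 w.2‖ ≤ C := by
  filter_upwards [Measure.quasiMeasurePreserving_fst.ae (ae_restrict_mem measurableSet_Icc),
    Measure.quasiMeasurePreserving_snd.ae (ae_restrict_mem measurableSet_Icc)] with w h1 h2
  exact hk.bound _ h1 _ h2

lemma IsKer.isPull₁ (hk : IsKer a b k C) :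
    IsPull ((μ₁ a b).prod (μ₁ a b)) (μ₁ a b) Prod.snd (fun w => k w.1 w.2) (b - a).toNNReal C where
  meas := measurable_snd
  map_le := by rw [Measure.map_snd_prod, μ₁_univ]; exact le_rfl
  ker_meas := hk.meas
  ker_bound := hk.ae_bound

/-- The map `((s, x), t) ↦ (s, t)` forgets `x`, so it pushes the product measure to `b - a` times
the measure on the rectangle. -/
lemma IsKer.isPull₂ (hk : IsKer a b k C) :
    IsPull ((μ₂ a b).prod (μ₁ a b)) (μ₂ a b) (fun w => (w.1.1, w.2)) (fun w => k w.1.2 w.2)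
      (b - a).toNNReal C where
  meas := by fun_prop
  map_le := by
    have : (fun w : (ℝ × ℝ) × ℝ => (w.1.1, w.2)) = Prod.map Prod.fst id := rfl
    rw [this, ← Measure.map_prod_map _ _ measurable_fst measurable_id, Measure.map_id, μ₂_eq,
      Measure.map_fst_prod, μ₁_univ, Measure.prod_smul_left]
    exact le_rfl
  ker_meas := hk.meas.comp (by fun_prop : Measurable fun w : (ℝ × ℝ) × ℝ => (w.1.2, w.2))
  ker_bound := by
    filter_upwards [Measure.quasiMeasurePreserving_fst.ae
      (ae_snd_of_ae (ae_restrict_mem measurableSet_Icc)),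
      Measure.quasiMeasurePreserving_snd.ae (ae_restrict_mem measurableSet_Icc)] with w h1 h2
    exact hk.bound _ h1 _ h2

/-- The operator `u ↦ ∫_a^b k(·,t) u(t) dt` on `L₂[a,b]`. -/
def IsKer.opL (hk : IsKer a b k C) : L2x n a b →L[ℝ] L2x n a b := kerOp hk.isPull₁

lemma IsKer.opL_ae (hk : IsKer a b k C) (u : L2x n a b) : hk.opL u =ᵐ[μ₁ a b] fOp a b k u :=
  kerOp_ae hk.isPull₁ u

/-- The operator `ψ ↦ ∫_a^b k(x,t) ψ(s,t) dt` on `L₂([0,1] × [a,b])`. -/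
def IsKer.opLs (hk : IsKer a b k C) : L2sx n a b →L[ℝ] L2sx n a b := kerOp hk.isPull₂

lemma IsKer.opLs_ae (hk : IsKer a b k C) (ψ : L2sx n a b) :
    hk.opLs ψ =ᵐ[μ₂ a b] fun z => fOp a b k (fun t => ψ (z.1, t)) z.2 :=
  kerOp_ae hk.isPull₂ ψ

/-! ### Integration in `s` and constant extension in `s`. -/

/-- The scalar kernel `1_{σ < s}`. -/
def stepKer (n : ℕ) (s σ : ℝ) : E n →L[ℝ] E n := if σ < s then 1 else 0

lemma stepKer_apply (s σ : ℝ) (e : E n) : stepKer n s σ e = if σ < s then e else 0 := by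
  by_cases h : σ < s <;> simp [stepKer, h]

lemma measurable_stepKer : Measurable (Function.uncurry (stepKer n)) :=
  Measurable.ite (measurableSet_lt measurable_snd measurable_fst) measurable_const measurable_const

lemma norm_stepKer_le (s σ : ℝ) : ‖stepKer n s σ‖ ≤ (1 : ℝ≥0) := by
  unfold stepKer
  split_ifs
  · exact ContinuousLinearMap.norm_id_le
  · simp

lemma isPull_prim : IsPull ((μ₂ a b).prod (μ₁ 0 1)) (μ₂ a b) (fun w => (w.2, w.1.2))
    (fun w => stepKer n w.1.1 w.2) 1 1 where
  meas := by fun_prop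
  map_le := by
    have : (fun w : (ℝ × ℝ) × ℝ => (w.2, w.1.2)) = Prod.swap ∘ Prod.map Prod.snd id := rfl
    rw [this, ← Measure.map_map measurable_swap (by fun_prop),
      ← Measure.map_prod_map _ _ measurable_snd measurable_id, Measure.map_id, map_snd_μ₂,
      Measure.prod_swap, ← μ₂_eq, one_smul]
  ker_meas := measurable_stepKer.comp
    (by fun_prop : Measurable fun w : (ℝ × ℝ) × ℝ => (w.1.1, w.2))
  ker_bound := Filter.Eventually.of_forall fun w => norm_stepKer_le _ _

lemma isPull_primAt (s : ℝ) : IsPull ((μ₁ a b).prod (μ₁ 0 1)) (μ₂ a b) Prod.swap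
    (fun w => stepKer n s w.2) 1 1 where
  meas := measurable_swap
  map_le := by rw [Measure.prod_swap, ← μ₂_eq, one_smul]
  ker_meas := measurable_stepKer.comp (by fun_prop : Measurable fun w : ℝ × ℝ => (s, w.2))
  ker_bound := Filter.Eventually.of_forall fun w => norm_stepKer_le _ _

lemma isPull_extend : IsPull (μ₂ a b) (μ₁ a b) Prod.snd (fun _ => (1 : E n →L[ℝ] E n)) 1 1 where
  meas := measurable_snd
  map_le := by rw [map_snd_μ₂, one_smul]
  ker_meas := measurable_const
  ker_bound := Filter.Eventually.of_forall fun w => ContinuousLinearMap.norm_id_le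

/-- The operator `(V ψ)(s,x) = ∫_0^s ψ(σ,x) dσ`. -/
def prim : L2sx n a b →L[ℝ] L2sx n a b := kerOp isPull_prim

/-- The operator `ψ ↦ ∫_0^s ψ(σ,·) dσ` at a fixed `s`. -/
def primAt (s : ℝ) : L2sx n a b →L[ℝ] L2x n a b := kerOp (isPull_primAt s)

/-- The extension of `v` to a function of `(s,x)` that is constant in `s`. -/
def extend : L2x n a b →L[ℝ] L2sx n a b := isPull_extend.pullL

lemma prim_ae (ψ : L2sx n a b) :
    prim ψ =ᵐ[μ₂ a b] fun z => ∫ σ, (if σ < z.1 then ψ (σ, z.2) else 0) ∂(μ₁ 0 1) := by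
  refine (kerOp_ae isPull_prim ψ).trans (Filter.Eventually.of_forall fun z => ?_)
  simp only [stepKer_apply]

lemma primAt_ae (s : ℝ) (ψ : L2sx n a b) :
    primAt s ψ =ᵐ[μ₁ a b] fun x => ∫ σ, (if σ < s then ψ (σ, x) else 0) ∂(μ₁ 0 1) := by
  refine (kerOp_ae (isPull_primAt s) ψ).trans (Filter.Eventually.of_forall fun z => ?_)
  simp only [stepKer_apply, Prod.swap_prod_mk]

lemma extend_ae (v : L2x n a b) : extend v =ᵐ[μ₂ a b] fun z => v z.2 :=
  isPull_extend.pullL_ae v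

lemma prim_ae_primAt (ψ : L2sx n a b) :
    ∀ᵐ s ∂(μ₁ 0 1), ∀ᵐ x ∂(μ₁ a b), prim ψ (s, x) = primAt s ψ x := by
  filter_upwards [ae_ae_of_ae_μ₂ (prim_ae ψ)] with s hs
  filter_upwards [hs, primAt_ae s ψ] with x h1 h2
  rw [h1, h2]

lemma primAt_zero (ψ : L2sx n a b) : primAt 0 ψ = 0 := by
  refine Lp.ext ?_
  filter_upwards [primAt_ae 0 ψ, Lp.coeFn_zero (E n) 2 (μ₁ a b)] with x h1 h2
  rw [h1, h2, Pi.zero_apply]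
  refine integral_eq_zero_of_ae ?_
  filter_upwards [ae_restrict_mem measurableSet_Icc] with σ hσ
  simp [hσ.1.not_gt]

lemma primAt_one_ae (ψ : L2sx n a b) :
    primAt 1 ψ =ᵐ[μ₁ a b] fun x => ∫ σ, ψ (σ, x) ∂(μ₁ 0 1) := by
  filter_upwards [primAt_ae 1 ψ] with x h1
  rw [h1]
  refine integral_congr_ae ?_
  filter_upwards [μ₁_ae_mem_Ioo 0 1] with σ hσ
  simp [hσ.2]

lemma primAt_one_extend (v : L2x n a b) : primAt 1 (extend v) = v := by
  refine Lp.ext ?_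
  filter_upwards [primAt_one_ae (extend v), ae_ae_swap_of_ae_μ₂ (extend_ae v)] with x h1 h2
  rw [h1, integral_congr_ae h2, integral_const, Measure.real, μ₁_unit_univ]
  simp

/-- The difference is the integral of `ψ` over the strip `s' ≤ σ < s`, and Cauchy–Schwarz over that
strip gives the square root. This Hölder bound makes the slices continuous in `s`. -/
lemma norm_primAt_sub_le (ψ : L2sx n a b) {s s' : ℝ} (hs' : 0 ≤ s') (hss : s' ≤ s) (hs : s ≤ 1) :
    ‖primAt s ψ - primAt s' ψ‖ ≤ Real.sqrt (s - s') * ‖ψ‖ := by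
  set θ : Measure ℝ := volume.restrict (Ico s' s) with hθ
  have hθr : θ.real univ = s - s' := by
    rw [hθ, measureReal_restrict_apply_univ, Real.volume_real_Ico_of_le hss]
  have hle : ((μ₁ a b).prod θ).map Prod.swap ≤ μ₂ a b := by
    rw [Measure.prod_swap, μ₁, hθ, Measure.prod_restrict]
    have hsub : Ico s' s ⊆ Icc 0 1 := fun x hx => ⟨hs'.trans hx.1, hx.2.le.trans hs⟩
    exact Measure.restrict_mono (prod_mono hsub subset_rfl) le_rfl
  have hψ : AEStronglyMeasurable ψ (((μ₁ a b).prod θ).map Prod.swap) :=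
    (Lp.aestronglyMeasurable ψ).mono_measure hle
  have h1 : (primAt s ψ - primAt s' ψ : L2x n a b) =ᵐ[μ₁ a b]
      fun x => ∫ σ, (ψ ∘ Prod.swap) (x, σ) ∂θ := by
    have hint : ∀ᵐ x ∂(μ₁ a b), Integrable (fun σ => ψ (σ, x)) (μ₁ 0 1) :=
      (integrable_prod_L2sx ψ).prod_left_ae
    filter_upwards [Lp.coeFn_sub (primAt s ψ) (primAt s' ψ), primAt_ae s ψ, primAt_ae s' ψ,
      hint] with x hx h1 h2 h3
    have e : ∀ r, (fun σ => if σ < r then ψ (σ, x) else 0) = (Iio r).indicator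
        fun σ => ψ (σ, x) := fun r => by ext1 σ; simp [indicator_apply]
    rw [hx, Pi.sub_apply, h1, h2, e, e, ← integral_sub (h3.indicator measurableSet_Iio)
      (h3.indicator measurableSet_Iio)]
    have e2 : (fun σ => (Iio s).indicator (fun σ => ψ (σ, x)) σ
        - (Iio s').indicator (fun σ => ψ (σ, x)) σ) = (Ico s' s).indicator fun σ => ψ (σ, x) := by
      ext1 σ
      by_cases h : σ < s'
      · simp [h, h.trans_le hss, h.not_ge]
      · simp [indicator_apply, h, not_lt.1 h]
    rw [e2, setIntegral_indicator measurableSet_Ico, inter_eq_right.2]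
    · rfl
    · exact fun x hx => ⟨hs'.trans hx.1, hx.2.le.trans hs⟩
  rw [Lp.norm_def, Lp.norm_def, eLpNorm_congr_ae h1]
  refine (ENNReal.toReal_mono ?_ ((eLpNorm_integral_le
    (hψ.comp_measurable measurable_swap)).trans (mul_le_mul_right
      ((eLpNorm_map_measure hψ measurable_swap.aemeasurable).symm.le.trans
        (eLpNorm_mono_measure ψ hle)) _))).trans ?_
  · exact ENNReal.mul_ne_top ENNReal.ofReal_ne_top (Lp.eLpNorm_ne_top ψ)
  · rw [ENNReal.toReal_mul, ENNReal.toReal_ofReal (Real.sqrt_nonneg _), hθr]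

lemma continuousOn_primAt (ψ : L2sx n a b) :
    ContinuousOn (fun s => primAt s ψ) (Icc 0 1) := by
  have key : ∀ s ∈ Icc (0 : ℝ) 1, ∀ r ∈ Icc (0 : ℝ) 1,
      ‖primAt s ψ - primAt r ψ‖ ≤ Real.sqrt |s - r| * ‖ψ‖ := by
    intro s hs r hr
    rcases le_total r s with h | h
    · rw [abs_of_nonneg (sub_nonneg.2 h)]
      exact norm_primAt_sub_le ψ hr.1 h hs.2
    · rw [norm_sub_rev, abs_sub_comm, abs_of_nonneg (sub_nonneg.2 h)]
      exact norm_primAt_sub_le ψ hs.1 h hr.2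
  intro r hr
  rw [ContinuousWithinAt, tendsto_iff_norm_sub_tendsto_zero]
  have hlim : Filter.Tendsto (fun s => Real.sqrt |s - r| * ‖ψ‖) (nhdsWithin r (Icc 0 1))
      (nhds 0) := by
    have hc : Continuous fun s => Real.sqrt |s - r| * ‖ψ‖ := by fun_prop
    have := hc.tendsto r
    simp only [sub_self, abs_zero, Real.sqrt_zero, zero_mul] at this
    exact this.mono_left nhdsWithin_le_nhds
  refine squeeze_zero' (Filter.Eventually.of_forall fun _ => norm_nonneg _) ?_ hlim
  filter_upwards [self_mem_nhdsWithin] with s hs using key s hs r hr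

/-- Integral operators in `x` commute with integration in `s`. -/
lemma IsKer.opL_primAt (hk : IsKer a b k C) (s : ℝ) (ψ : L2sx n a b) :
    hk.opL (primAt s ψ) = primAt s (hk.opLs ψ) := by
  refine Lp.ext ?_
  have hint : ∀ᵐ t ∂(μ₁ a b), Integrable (fun σ => ψ (σ, t)) (μ₁ 0 1) :=
    (integrable_prod_L2sx ψ).prod_left_ae
  filter_upwards [hk.opL_ae (primAt s ψ), primAt_ae s (hk.opLs ψ), ae_restrict_mem measurableSet_Icc,
    ae_ae_swap_of_ae_μ₂ (hk.opLs_ae ψ)] with x h1 h2 hx h3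
  have hprod : Integrable (Function.uncurry fun t σ => if σ < s then k x t (ψ (σ, t)) else 0)
      ((μ₁ a b).prod (μ₁ 0 1)) := by
    have h0 : Integrable (fun w : ℝ × ℝ => ψ w.swap) ((μ₁ a b).prod (μ₁ 0 1)) :=
      (integrable_prod_L2sx ψ).swap
    have hms : MeasurableSet {w : ℝ × ℝ | w.2 < s} := measurableSet_lt measurable_snd measurable_const
    have hm : AEStronglyMeasurable (fun w : ℝ × ℝ => k x w.1 (ψ w.swap))
        ((μ₁ a b).prod (μ₁ 0 1)) :=
      (ContinuousLinearMap.apply ℝ (E n)).flip.aestronglyMeasurable_comp₂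
        (hk.meas.comp (by fun_prop : Measurable fun w : ℝ × ℝ =>
          (x, w.1))).stronglyMeasurable.aestronglyMeasurable h0.1
    have h4 : Integrable (fun w : ℝ × ℝ => k x w.1 (ψ w.swap)) ((μ₁ a b).prod (μ₁ 0 1)) := by
      refine (h0.norm.const_mul (C : ℝ)).mono' hm ?_
      filter_upwards [Measure.quasiMeasurePreserving_fst.ae (ae_restrict_mem measurableSet_Icc)]
        with w hw
      exact (k x w.1).le_of_opNorm_le (hk.bound x hx _ hw) _
    refine (h4.indicator hms).congr (Filter.Eventually.of_forall ?_)
    rintro ⟨t, σ⟩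
    by_cases h : σ < s <;> simp [Function.uncurry, h]
  rw [h1, h2, fOp]
  have e1 : (fun t => k x t (primAt s ψ t)) =ᵐ[μ₁ a b]
      fun t => ∫ σ, (if σ < s then k x t (ψ (σ, t)) else 0) ∂(μ₁ 0 1) := by
    filter_upwards [primAt_ae s ψ, hint] with t ht h5
    have h6 : Integrable (fun σ => if σ < s then ψ (σ, t) else 0) (μ₁ 0 1) := by
      refine (h5.indicator measurableSet_Iio (s := Iio s)).congr (Filter.Eventually.of_forall ?_)
      intro t; simp [indicator_apply]
    rw [ht, ← (k x t).integral_comp_comm h6]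
    congr 1
    ext1 σ
    split_ifs <;> simp
  rw [integral_congr_ae e1, integral_integral_swap hprod]
  refine integral_congr_ae ?_
  filter_upwards [h3] with σ hσ
  by_cases h : σ < s
  · simp only [h, if_true, hσ]; rfl
  · simp [h]

end LpOperators

/-! ### The space `H₂` and its boundary conditions -/

section SpaceH2

open scoped NNReal ENNReal

variable {n : ℕ} {a b : ℝ}

lemma L2x_eq_of_test {u w : L2x n a b}
    (h : ∀ η, IsTest (Ioo a b) η → ∫ x, η x • u x ∂(μ₁ a b) = ∫ x, η x • w x ∂(μ₁ a b)) :
    u = w := by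
  have h0 : (fun x => u x - w x) =ᵐ[μ₁ a b] 0 := by
    refine ae_eq_zero_of_test ((integrable_L2x u).sub (integrable_L2x w)) fun η hη => ?_
    simp only [smul_sub]
    rw [integral_sub (hη.integrable_smul u) (hη.integrable_smul w), h η hη, sub_self]
  exact Lp.ext (h0.mono fun x hx => sub_eq_zero.1 hx)

/-- Weak derivatives are unique by the fundamental lemma. -/
lemma H2.ext_zero {u w : H2 n a b} (h : H2.d 0 u = H2.d 0 w) : u = w := by
  refine Subtype.ext (funext fun j => L2x_eq_of_test fun η hη => ?_)
  have h1 := u.2 j η hη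
  have h2 := w.2 j η hη
  have h' : u.1 0 = w.1 0 := h
  rw [h', h2] at h1
  exact (smul_right_injective _ (pow_ne_zero _ (by norm_num : (-1 : ℝ) ≠ 0)) h1).symm

variable (B : Matrix (Fin 2 × Fin n) (Fin 4 × Fin n) ℝ)

variable (a b) in
/-- The operator `∂ₓʲ 𝒯₁` on `L₂[a,b]`. -/
def opT (j : Fin 3) : L2x n a b →L[ℝ] L2x n a b :=
  ![(exists_isKer₀ a b B).choose_spec.opL, (exists_isKer₁ a b B).choose_spec.opL,
    ContinuousLinearMap.id ℝ _] j

lemma opT_ae (j : Fin 3) (u : L2x n a b) : opT a b B j u =ᵐ[μ₁ a b] fT a b B j u := by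
  fin_cases j
  · exact (exists_isKer₀ a b B).choose_spec.opL_ae u
  · exact (exists_isKer₁ a b B).choose_spec.opL_ae u
  · rfl

/-- `𝒯₁ u` is a constant plus the primitive of `∂ₓ𝒯₁ u`, which is a constant plus the primitive of
`u`. Two integrations by parts against the test function finish the proof. -/
lemma isWeakDeriv₁_opT (hab : a ≤ b) (u : L2x n a b) (j : Fin 3) :
    IsWeakDeriv₁ j (opT a b B 0 u) (opT a b B j u) := by
  have hu := integrable_L2x u
  have key1 : ∀ η, IsTest (Ioo a b) η →
      ∫ x, dirDeriv 1 η x • opT a b B 0 u x ∂(μ₁ a b) = -∫ x, η x • opT a b B 1 u x ∂(μ₁ a b) := by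
    intro η hη
    refine integral_dirDeriv_smul hab hη (c := affine B a b 0 u) (integrable_L2x _) ?_
    filter_upwards [opT_ae B 0 u, ae_restrict_mem measurableSet_Icc] with x hx hx2
    rw [hx]
    refine (fOp_ker₀_primitive B hu hx2).trans ?_
    congr 1
    refine integral_congr_ae ?_
    filter_upwards [opT_ae B 1 u] with y hy
    rw [hy]; rfl
  have key2 : ∀ η, IsTest (Ioo a b) η →
      ∫ x, dirDeriv 1 η x • opT a b B 1 u x ∂(μ₁ a b) = -∫ x, η x • opT a b B 2 u x ∂(μ₁ a b) := by
    intro η hη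
    refine integral_dirDeriv_smul hab hη (c := affine B a b 1 u) (integrable_L2x _) ?_
    filter_upwards [opT_ae B 1 u] with x hx
    rw [hx]
    exact fOp_ker₁_eq B hu
  intro η hη
  fin_cases j
  · simp
  · simpa using key1 η hη
  · have h1 := key1 _ (hη.dirDeriv 1)
    have h2 := key2 η hη
    rw [h2, neg_neg] at h1
    simpa using h1

/-- The operator `𝒯₁ : L₂ → H₂`. -/
def liftH2 (hab : a ≤ b) : L2x n a b →L[ℝ] H2 n a b :=
  (ContinuousLinearMap.pi fun j => opT a b B j).codRestrict (H2 n a b)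
    fun u j => isWeakDeriv₁_opT B hab u j

lemma d_liftH2 (hab : a ≤ b) (u : L2x n a b) (j : Fin 3) :
    H2.d j (liftH2 B hab u) = opT a b B j u := rfl

/-- The condition on `c` is the solution of `BHc = -Bw`. This is what dictates the form of `T₂`. -/
lemma boundary_eq (c : Fin 2 → E n) (w : Fin 4 × Fin n → ℝ) (hB : IsUnit (B * Hmat n a b))
    (hc : ∀ p, c p.1 p.2 = -(((B * Hmat n a b)⁻¹ * B).mulVec w) p) :
    B.mulVec ((Hmat n a b).mulVec (fun p => c p.1 p.2) + w) = 0 := by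
  have hc' : (fun p : Fin 2 × Fin n => c p.1 p.2) = -((B * Hmat n a b)⁻¹ * B).mulVec w :=
    funext hc
  have hdet := (Matrix.isUnit_iff_isUnit_det _).1 hB
  rw [hc', Matrix.mulVec_add, Matrix.mulVec_mulVec, Matrix.mulVec_neg, Matrix.mulVec_mulVec,
    ← Matrix.mul_assoc, Matrix.mul_nonsing_inv _ hdet, Matrix.one_mul, neg_add_cancel]

lemma Hmat_mulVec (c : Fin 2 → E n) (p : Fin 4 × Fin n) :
    (Hmat n a b).mulVec (fun p => c p.1 p.2) p
      = (![c 0, c 0 + (b - a) • c 1, c 1, c 1] p.1) p.2 := by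
  obtain ⟨p, q⟩ := p
  fin_cases p <;>
    simp [Hmat, Matrix.mulVec, dotProduct, Fintype.sum_prod_type, Matrix.one_apply]

/-- The boundary vector of `𝒯₁ u` is `Hc + ∫ Q u`, where `c` holds the affine coefficients; these
equal `-(BH)⁻¹ B ∫ Q u`, so `boundary_eq` applies. -/
lemma memX_liftH2 (hab : a < b) (hB : IsUnit (B * Hmat n a b)) (u : L2x n a b) :
    MemX B (liftH2 B hab.le u) := by
  have hu := integrable_L2x u
  refine ⟨fOp a b (ker₀ a b B) u, fOp a b (ker₁ a b B) u, continuousOn_fOp_ker₀ B hu,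
    (opT_ae B 0 u).symm, continuousOn_fOp_ker₁ B hu, (opT_ae B 1 u).symm, ?_⟩
  have hu' : Integrable (fun t => (b - t) • u t) (μ₁ a b) :=
    IntegrableOn.continuousOn_smul hu (by fun_prop) isCompact_Icc
  -- The integrand `Q(t) u(t)`: its integral is the part of the boundary vector contributed by the
  -- double primitive.
  let w : ℝ → Fin 4 × Fin n → ℝ := fun t p => (![0, (b - t) • u t, 0, u t] p.1) p.2
  have hw : ∀ t, w t = (Qmat n b t).mulVec (u t).ofLp := by
    intro t
    ext ⟨p, q⟩
    fin_cases p <;> simp [w, Qmat, Matrix.mulVec, dotProduct, Matrix.one_apply]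
  have hcoord : ∀ {f : ℝ → E n}, Integrable f (μ₁ a b) → ∀ q,
      Integrable (fun t => f t q) (μ₁ a b) := fun hf q =>
    (EuclideanSpace.proj (𝕜 := ℝ) q).integrable_comp hf
  have hicoord : ∀ {f : ℝ → E n}, Integrable f (μ₁ a b) → ∀ q,
      (∫ t, f t ∂(μ₁ a b)) q = ∫ t, f t q ∂(μ₁ a b) := fun hf q =>
    ((EuclideanSpace.proj (𝕜 := ℝ) q).integral_comp_comm hf).symm
  have hwi : Integrable w (μ₁ a b) := by
    refine Integrable.of_eval ?_
    rintro ⟨p, q⟩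
    fin_cases p
    · simp [w]
    · exact hcoord hu' q
    · simp [w]
    · exact hcoord hu q
  have hwe : ∀ p, (∫ t, w t ∂(μ₁ a b)) p = ∫ t, w t p ∂(μ₁ a b) := fun p =>
    ((ContinuousLinearMap.proj (R := ℝ) (φ := fun _ => ℝ) p).integral_comp_comm hwi).symm
  have hc : ∀ p : Fin 2 × Fin n, affine B a b p.1 u p.2
      = -(((B * Hmat n a b)⁻¹ * B).mulVec (∫ t, w t ∂(μ₁ a b))) p := by
    intro p
    have h1 := ((ContinuousLinearMap.proj (R := ℝ) (φ := fun _ => ℝ) p).comp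
      (LinearMap.toContinuousLinearMap
        (Matrix.mulVecLin ((B * Hmat n a b)⁻¹ * B)))).integral_comp_comm hwi
    simp only [ContinuousLinearMap.comp_apply, LinearMap.coe_toContinuousLinearMap',
      Matrix.mulVecLin_apply, ContinuousLinearMap.proj_apply] at h1
    rw [← h1, affine, hicoord (integrable_coef B p.1 hu), ← integral_neg]
    congr 1
    ext1 t
    rw [hw, Matrix.mulVec_mulVec]
    simp [actL_apply, act, coef, Matrix.mulVec, dotProduct]
  rw [← boundary_eq B (fun i => affine B a b i u) (∫ t, w t ∂(μ₁ a b)) hB hc]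
  congr 1
  ext p
  rw [Pi.add_apply, Hmat_mulVec (fun i => affine B a b i u), hwe]
  have hb : b ∈ Icc a b := right_mem_Icc.2 hab.le
  have hlt : ∀ᵐ t ∂(μ₁ a b), t < b := (μ₁_ae_mem_Ioo a b).mono fun t ht => ht.2
  have e1 : fOp a b (ker₀ a b B) u b = affine B a b 0 u + (b - a) • affine B a b 1 u
      + ∫ t, (b - t) • u t ∂(μ₁ a b) := by
    rw [fOp_ker₀_eq B hu]
    congr 1
    exact integral_congr_ae (hlt.mono fun t ht => by simp [ht])
  have e2 : fOp a b (ker₁ a b B) u b = affine B a b 1 u + ∫ t, u t ∂(μ₁ a b) := by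
    rw [fOp_ker₁_eq B hu]
    congr 1
    exact integral_congr_ae (hlt.mono fun t ht => by simp [ht])
  rw [affine_zero_eq B hu, affine_one_eq B hu, e1, e2]
  obtain ⟨p, q⟩ := p
  fin_cases p
  · simp [w]
  · simp [w, hicoord hu']
  · simp [w]
  · simp [w, hicoord hu]

lemma MemX.sub {u w : H2 n a b} (hu : MemX B u) (hw : MemX B w) : MemX B (u - w) := by
  obtain ⟨f, g, hf, hf', hg, hg', h⟩ := hu
  obtain ⟨f₂, g₂, hf₂, hf₂', hg₂, hg₂', h₂⟩ := hw
  have hs : ∀ j, H2.d j (u - w) =ᵐ[μ₁ a b] fun x => H2.d j u x - H2.d j w x := fun j =>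
    Lp.coeFn_sub _ _
  refine ⟨fun x => f x - f₂ x, fun x => g x - g₂ x, hf.sub hf₂, ?_, hg.sub hg₂, ?_, ?_⟩
  · filter_upwards [hs 0, hf', hf₂'] with x h1 h2 h3
    rw [h1, h2, h3]
  · filter_upwards [hs 1, hg', hg₂'] with x h1 h2 h3
    rw [h1, h2, h3]
  · rw [← sub_zero (0 : Fin 2 × Fin n → ℝ)]
    nth_rewrite 1 [← h]
    rw [← h₂, ← Matrix.mulVec_sub]
    congr 1
    ext ⟨p, q⟩
    fin_cases p <;> rfl

/-- An element of `X_B` with vanishing second derivative is zero. -/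
lemma MemX.eq_zero (hab : a < b) (hB : IsUnit (B * Hmat n a b)) {u : H2 n a b} (hu : MemX B u)
    (h2 : H2.d 2 u = 0) : u = 0 := by
  obtain ⟨f, g, hf, hf', hg, hg', hbc⟩ := hu
  have hfi : Integrable f (μ₁ a b) := hf.integrableOn_compact isCompact_Icc
  have hd1 : ∀ η, IsTest (Ioo a b) η → ∫ x, dirDeriv 1 η x • f x ∂(μ₁ a b)
      = -∫ x, η x • g x ∂(μ₁ a b) := by
    intro η hη
    have := u.2 1 η hη
    simp only [Fin.val_one, Function.iterate_one, pow_one, neg_smul, one_smul] at this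
    refine (integral_congr_ae (hf'.mono fun x hx => ?_)).trans
      (this.trans (congrArg _ (integral_congr_ae (hg'.mono fun x hx => ?_))))
    · rw [hx]; rfl
    · dsimp only; rw [hx]; rfl
  -- The weak derivative of `u_x` is `u_xx = 0`, so its continuous representative is constant.
  have hg0 : ∀ x ∈ Icc a b, g x = g a := by
    refine eqOn_const_of_weak_deriv_zero hab hg fun η hη => ?_
    have h1 := hd1 _ (hη.dirDeriv 1)
    have h3 := u.2 2 η hη
    have h2' : u.1 2 = 0 := h2
    rw [h2', integral_smul_zero, smul_zero] at h3
    rw [← neg_eq_zero, ← h1, ← h3]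
    refine integral_congr_ae (hf'.mono fun x hx => ?_)
    dsimp only
    rw [hx]; rfl
  have hga : g =ᵐ[μ₁ a b] fun _ => g a := by
    filter_upwards [ae_restrict_mem measurableSet_Icc] with x hx using hg0 x hx
  -- Subtracting the linear function of slope `g a` leaves a continuous function with zero weak
  -- derivative, so `f` is affine.
  have hlin : ∀ x ∈ Icc a b, f x - (x - a) • g a = f a - (a - a) • g a := by
    refine eqOn_const_of_weak_deriv_zero hab (f := fun x => f x - (x - a) • g a)
      (hf.sub (by fun_prop)) fun η hη => ?_
    have hi : Integrable (fun x => (x - a) • g a) (μ₁ a b) :=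
      ContinuousOn.integrableOn_compact isCompact_Icc (by fun_prop)
    have h1 : ∫ x, dirDeriv 1 η x • (x - a) • g a ∂(μ₁ a b)
        = -∫ x, η x • g a ∂(μ₁ a b) := by
      refine integral_dirDeriv_smul hab.le hη (c := 0) (f := fun _ => g a) (integrable_const _) ?_
      filter_upwards [ae_restrict_mem measurableSet_Icc] with x hx
      rw [← primitive_eq hx]
      simp
    have hsm : ∀ {g : ℝ → E n}, Integrable g (μ₁ a b) →
        Integrable (fun x => dirDeriv 1 η x • g x) (μ₁ a b) := fun hg =>
      hg.locallyIntegrable.integrable_smul_left_of_hasCompactSupport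
        (hη.dirDeriv 1).smooth.continuous (hη.dirDeriv 1).compact
    simp only [smul_sub]
    rw [integral_sub (hsm hfi) (hsm hi), h1, hd1 η hη,
      integral_congr_ae (g := fun x => η x • g a) (hga.mono fun x hx => by dsimp only; rw [hx]),
      sub_self]
  have hb : b ∈ Icc a b := right_mem_Icc.2 hab.le
  have hfb : f b = f a + (b - a) • g a := by
    have := hlin b hb
    rw [sub_self, zero_smul, sub_zero, sub_eq_iff_eq_add] at this
    exact this
  have hgb := hg0 b hb
  let c : Fin 2 → E n := ![f a, g a]
  -- The boundary vector of an affine function is `H` applied to its value and slope at `a`.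
  have hH : (B * Hmat n a b).mulVec (fun p => c p.1 p.2) = 0 := by
    rw [← hbc, ← Matrix.mulVec_mulVec]
    congr 1
    ext p
    rw [Hmat_mulVec, hfb, hgb]
    rfl
  have hc : (fun p : Fin 2 × Fin n => c p.1 p.2) = 0 := by
    have hdet := (Matrix.isUnit_iff_isUnit_det _).1 hB
    rw [← Matrix.one_mulVec (fun p : Fin 2 × Fin n => c p.1 p.2),
      ← Matrix.nonsing_inv_mul _ hdet, ← Matrix.mulVec_mulVec, hH, Matrix.mulVec_zero]
  have hfa0 : f a = 0 := by ext q; exact congrFun hc (0, q)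
  have hga0 : g a = 0 := by ext q; exact congrFun hc (1, q)
  refine H2.ext_zero (Lp.ext ?_)
  filter_upwards [hf', ae_restrict_mem measurableSet_Icc, Lp.coeFn_zero (E n) 2 (μ₁ a b)]
    with x h1 hx h0
  have := hlin x hx
  rw [hfa0, hga0, smul_zero, smul_zero, sub_zero, sub_zero] at this
  rw [← h1, this]
  exact h0.symm

end SpaceH2

/-! ### Test functions of two variables -/

section TestFunctions

variable {n : ℕ} {a b : ℝ}

lemma integral_μ₂ {f : ℝ × ℝ → E n} (hf : Integrable f (μ₂ a b)) :
    ∫ z, f z ∂(μ₂ a b) = ∫ s, ∫ x, f (s, x) ∂(μ₁ a b) ∂(μ₁ 0 1) := by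
  rw [μ₂_eq] at hf ⊢
  exact integral_prod f hf

lemma integral_μ₂_symm {f : ℝ × ℝ → E n} (hf : Integrable f (μ₂ a b)) :
    ∫ z, f z ∂(μ₂ a b) = ∫ x, ∫ s, f (s, x) ∂(μ₁ 0 1) ∂(μ₁ a b) := by
  rw [μ₂_eq] at hf ⊢
  exact integral_prod_symm f hf

lemma μ₂_ae_mem_Ioo (a b : ℝ) : ∀ᵐ z ∂(μ₂ a b), z ∈ Ioo (0 : ℝ) 1 ×ˢ Ioo a b := by
  filter_upwards [ae_fst_of_ae (μ₁_ae_mem_Ioo 0 1), ae_snd_of_ae (μ₁_ae_mem_Ioo a b)]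
    with z h1 h2 using ⟨h1, h2⟩

lemma L2sx_eq_of_test {u w : L2sx n a b}
    (h : ∀ η, IsTest (Ioo 0 1 ×ˢ Ioo a b) η →
      ∫ z, η z • u z ∂(μ₂ a b) = ∫ z, η z • w z ∂(μ₂ a b)) : u = w := by
  have hi := (integrable_L2sx u).sub (integrable_L2sx w)
  have := IsOpen.ae_eq_zero_of_integral_contDiff_smul_eq_zero
    ((isOpen_Ioo (a := (0 : ℝ)) (b := 1)).prod (isOpen_Ioo (a := a) (b := b)))
    (hi.locallyIntegrable.locallyIntegrableOn _) (fun η h1 h2 h3 => by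
      have hη : IsTest (Ioo 0 1 ×ˢ Ioo a b) η := ⟨h1, h2, h3⟩
      simp only [Pi.sub_apply, smul_sub]
      rw [integral_sub (hη.integrable_smul u) (hη.integrable_smul w), h η hη, sub_self])
  refine Lp.ext ?_
  filter_upwards [this, μ₂_ae_mem_Ioo a b] with z hz hz2
  exact sub_eq_zero.1 (hz hz2)

lemma H12.ext_zero {u w : H12 n a b} (h : H12.d 0 0 u = H12.d 0 0 w) : u = w := by
  refine Subtype.ext (funext fun ⟨i, j⟩ => L2sx_eq_of_test fun η hη => ?_)
  have h1 := u.2 i j η hη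
  have h2 := w.2 i j η hη
  have h' : u.1 (0, 0) = w.1 (0, 0) := h
  rw [h', h2] at h1
  exact (smul_right_injective _ (pow_ne_zero _ (by norm_num : (-1 : ℝ) ≠ 0)) h1).symm

variable {U : Set ℝ} {U' : Set ℝ} {η : ℝ × ℝ → ℝ}

lemma IsTest.slice_snd (h : IsTest (U ×ˢ U') η) (s : ℝ) : IsTest U' (fun x => η (s, x)) := by
  have hs : tsupport (fun x => η (s, x)) ⊆ {x | (s, x) ∈ tsupport η} :=
    closure_minimal (fun x hx => subset_tsupport η hx)
      ((isClosed_tsupport η).preimage (by fun_prop))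
  refine ⟨h.smooth.comp (by fun_prop), ?_, fun x hx => (h.supp (hs hx)).2⟩
  exact HasCompactSupport.of_support_subset_isCompact (h.compact.isCompact.image continuous_snd)
    fun x hx => ⟨(s, x), subset_tsupport η hx, rfl⟩

lemma IsTest.slice_fst (h : IsTest (U ×ˢ U') η) (x : ℝ) : IsTest U (fun s => η (s, x)) := by
  have hs : tsupport (fun s => η (s, x)) ⊆ {s | (s, x) ∈ tsupport η} :=
    closure_minimal (fun x hx => subset_tsupport η hx)
      ((isClosed_tsupport η).preimage (by fun_prop))
  refine ⟨h.smooth.comp (by fun_prop), ?_, fun x hx => (h.supp (hs hx)).1⟩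
  exact HasCompactSupport.of_support_subset_isCompact (h.compact.isCompact.image continuous_fst)
    fun s hs => ⟨(s, x), subset_tsupport η hs, rfl⟩

lemma dirDeriv_snd_apply (h : Differentiable ℝ η) (s x : ℝ) :
    dirDeriv (0, 1) η (s, x) = dirDeriv 1 (fun y => η (s, y)) x := by
  have h1 : HasDerivAt (fun y : ℝ => (s, y)) (0, 1) x :=
    (hasDerivAt_const x s).prodMk (hasDerivAt_id x)
  rw [dirDeriv_one]
  exact ((h (s, x)).hasFDerivAt.comp_hasDerivAt x h1).deriv.symm

lemma dirDeriv_fst_apply (h : Differentiable ℝ η) (s x : ℝ) :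
    dirDeriv (1, 0) η (s, x) = dirDeriv 1 (fun r => η (r, x)) s := by
  have h1 : HasDerivAt (fun r : ℝ => (r, x)) (1, 0) s :=
    (hasDerivAt_id s).prodMk (hasDerivAt_const s x)
  rw [dirDeriv_one]
  exact ((h (s, x)).hasFDerivAt.comp_hasDerivAt s h1).deriv.symm

lemma IsTest.differentiable {V : Type*} [NormedAddCommGroup V] [NormedSpace ℝ V] {U : Set V}
    {η : V → ℝ} (h : IsTest U η) : Differentiable ℝ η :=
  h.smooth.differentiable (by simp)

lemma IsTest.iterate_dirDeriv_snd (h : IsTest (U ×ˢ U') η) (j : ℕ) (s x : ℝ) :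
    (DelayPIE.dirDeriv ((0, 1) : ℝ × ℝ))^[j] η (s, x)
      = (DelayPIE.dirDeriv (1 : ℝ))^[j] (fun y => η (s, y)) x := by
  induction j generalizing η with
  | zero => rfl
  | succ j ih =>
    rw [Function.iterate_succ_apply, Function.iterate_succ_apply, ih (h.dirDeriv (0, 1))]
    exact congrArg (fun g => (DelayPIE.dirDeriv (1 : ℝ))^[j] g x)
      (funext fun y => dirDeriv_snd_apply h.differentiable s y)

lemma IsTest.mul_prod {α β : ℝ → ℝ} (hα : IsTest U α) (hβ : IsTest U' β) :
    IsTest (U ×ˢ U') (fun z => α z.1 * β z.2) := by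
  have hsub : Function.support (fun z : ℝ × ℝ => α z.1 * β z.2) ⊆ tsupport α ×ˢ tsupport β := by
    intro z hz
    have := mul_ne_zero_iff.1 hz
    exact ⟨subset_tsupport α this.1, subset_tsupport β this.2⟩
  refine ⟨(hα.smooth.comp contDiff_fst).mul (hβ.smooth.comp contDiff_snd),
    HasCompactSupport.of_support_subset_isCompact
      (hα.compact.isCompact.prod hβ.compact.isCompact) hsub, ?_⟩
  exact (closure_minimal hsub ((isClosed_tsupport α).prod (isClosed_tsupport β))).trans
    (prod_mono hα.supp hβ.supp)

lemma partialDeriv_one_two_mul {α β : ℝ → ℝ} (hα : IsTest U α) (hβ : IsTest U' β) (s x : ℝ) :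
    partialDeriv 1 2 (fun z => α z.1 * β z.2) (s, x)
      = dirDeriv 1 α s * (dirDeriv (1 : ℝ))^[2] β x := by
  have key : ∀ {β : ℝ → ℝ}, IsTest U' β → dirDeriv ((0, 1) : ℝ × ℝ) (fun z => α z.1 * β z.2)
      = fun z => α z.1 * dirDeriv 1 β z.2 := by
    intro β hβ
    ext ⟨s, x⟩
    rw [dirDeriv_snd_apply (hα.mul_prod hβ).differentiable, dirDeriv_one, dirDeriv_one]
    exact ((hβ.differentiable x).hasDerivAt.const_mul (α s)).deriv
  change dirDeriv (1, 0) (dirDeriv (0, 1) (dirDeriv (0, 1) fun z : ℝ × ℝ => α z.1 * β z.2)) (s, x)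
    = dirDeriv 1 α s * dirDeriv 1 (dirDeriv 1 β) x
  rw [key hβ, key (hβ.dirDeriv 1),
    dirDeriv_fst_apply (hα.mul_prod ((hβ.dirDeriv 1).dirDeriv 1)).differentiable]
  rw [dirDeriv_one]
  exact ((hα.differentiable s).hasDerivAt.mul_const (dirDeriv 1 (dirDeriv 1 β) x)).deriv

/-- `η` is bounded and the measure finite, so the pairing is a bounded functional. Slices continuous
in `s` thus stay continuous after testing in `x`. -/
lemma IsTest.continuous_integral {η : ℝ → ℝ} (h : IsTest U η) :
    Continuous fun u : L2x n a b => ∫ x, η x • u x ∂(μ₁ a b) := by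
  obtain ⟨M, hM⟩ := h.smooth.continuous.bounded_above_of_compact_support h.compact
  set K := (μ₁ a b univ) ^ (1 / (1 : ENNReal).toReal - 1 / (2 : ENNReal).toReal)
  let L : L2x n a b →ₗ[ℝ] E n :=
    { toFun := fun u => ∫ x, η x • u x ∂(μ₁ a b)
      map_add' := fun u w => integral_smul_add h u w
      map_smul' := fun c u => integral_smul_smul η c u }
  refine (L.mkContinuous (M * K.toReal) fun w => ?_).continuous
  have hw := integrable_L2x w
  have h1 : ∫ x, ‖w x‖ ∂(μ₁ a b) ≤ K.toReal * ‖w‖ := by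
    rw [integral_norm_eq_lintegral_enorm hw.1, ← eLpNorm_one_eq_lintegral_enorm, mul_comm,
      Lp.norm_def, ← ENNReal.toReal_mul]
    refine ENNReal.toReal_mono (ENNReal.mul_ne_top (Lp.eLpNorm_ne_top w) ?_)
      (eLpNorm_le_eLpNorm_mul_rpow_measure_univ (by norm_num) hw.1)
    exact ENNReal.rpow_ne_top_of_nonneg (by norm_num) (measure_ne_top _ _)
  have hM0 : 0 ≤ M := (norm_nonneg _).trans (hM 0)
  calc ‖∫ x, η x • w x ∂(μ₁ a b)‖ ≤ ∫ x, ‖η x • w x‖ ∂(μ₁ a b) := norm_integral_le_integral_norm _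
    _ ≤ ∫ x, M * ‖w x‖ ∂(μ₁ a b) := by
        refine integral_mono (h.integrable_smul w).norm (hw.norm.const_mul M) fun x => ?_
        rw [norm_smul]
        exact mul_le_mul_of_nonneg_right (hM x) (norm_nonneg _)
    _ = M * ∫ x, ‖w x‖ ∂(μ₁ a b) := integral_const_mul _ _
    _ ≤ M * (K.toReal * ‖w‖) := mul_le_mul_of_nonneg_left h1 hM0
    _ = M * K.toReal * ‖w‖ := (mul_assoc _ _ _).symm

/-- Fibrewise weak derivatives in `x` are weak derivatives. -/
lemma isWeakDeriv₂_of_slices {w : Fin 3 → L2sx n a b}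
    (h : ∀ᵐ s ∂(μ₁ 0 1), ∃ u : H2 n a b, ∀ j, ∀ᵐ x ∂(μ₁ a b), w j (s, x) = H2.d j u x)
    (j : Fin 3) : IsWeakDeriv₂ 0 j (w 0) (w j) := by
  intro η hη
  have hj : IsTest _ (partialDeriv 0 j η) := hη.iterate (0, 1) j
  rw [integral_μ₂ (hj.integrable_smul (w 0)), integral_μ₂ (hη.integrable_smul (w j)),
    ← integral_smul]
  refine integral_congr_ae ?_
  filter_upwards [h] with s ⟨u, hu⟩
  have := u.2 j _ (hη.slice_snd s)
  rw [zero_add]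
  refine (integral_congr_ae ((hu 0).mono fun x hx => ?_)).trans
    (this.trans (congrArg _ (integral_congr_ae ((hu j).mono fun x hx => ?_))))
  · have h1 : partialDeriv 0 j η (s, x)
        = (dirDeriv (1 : ℝ))^[j] (fun y => η (s, y)) x := hη.iterate_dirDeriv_snd j s x
    rw [hx, h1]; rfl
  · dsimp only; rw [hx]; rfl

/-- On almost every line `x = const` the function is `v x` plus the primitive of `ψ`, so the
one-dimensional integration by parts in `s` applies. -/
lemma integral_dirDeriv_fst_smul {ζ : ℝ × ℝ → ℝ} (hζ : IsTest (Ioo 0 1 ×ˢ Ioo a b) ζ)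
    (v : L2x n a b) (ψ : L2sx n a b) :
    ∫ z, dirDeriv ((1, 0) : ℝ × ℝ) ζ z • (extend v + prim ψ : L2sx n a b) z ∂(μ₂ a b)
      = -∫ z, ζ z • ψ z ∂(μ₂ a b) := by
  rw [integral_μ₂_symm ((hζ.dirDeriv (1, 0)).integrable_smul _),
    integral_μ₂_symm (hζ.integrable_smul ψ), ← integral_neg]
  refine integral_congr_ae ?_
  have hint : ∀ᵐ x ∂(μ₁ a b), Integrable (fun σ => ψ (σ, x)) (μ₁ 0 1) :=
    (integrable_prod_L2sx ψ).prod_left_ae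
  have hae : ∀ᵐ z ∂(μ₂ a b), (extend v + prim ψ : L2sx n a b) z
      = v z.2 + ∫ σ, (if σ < z.1 then ψ (σ, z.2) else 0) ∂(μ₁ 0 1) := by
    filter_upwards [Lp.coeFn_add (extend v) (prim ψ), extend_ae v, prim_ae ψ] with z h1 h2 h3
    rw [h1, Pi.add_apply, h2, h3]
  filter_upwards [hint, ae_ae_swap_of_ae_μ₂ hae] with x hx hx2
  simp only [dirDeriv_fst_apply hζ.differentiable]
  exact integral_dirDeriv_smul zero_le_one (hζ.slice_fst x) (c := v x) hx hx2

end TestFunctions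

/-! ### The reconstruction operator -/

section Reconstruction

variable {n : ℕ} {a b : ℝ} (B : Matrix (Fin 2 × Fin n) (Fin 4 × Fin n) ℝ)

variable (a b) in
/-- The operator `∂ₓʲ 𝒯₁`, acting in `x`, on `L₂([0,1] × [a,b])`. -/
def opTs (j : Fin 3) : L2sx n a b →L[ℝ] L2sx n a b :=
  ![(exists_isKer₀ a b B).choose_spec.opLs, (exists_isKer₁ a b B).choose_spec.opLs,
    ContinuousLinearMap.id ℝ _] j

lemma opTs_ae (j : Fin 3) (ψ : L2sx n a b) :
    opTs a b B j ψ =ᵐ[μ₂ a b] fun z => fT a b B j (fun t => ψ (z.1, t)) z.2 := by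
  fin_cases j
  · exact (exists_isKer₀ a b B).choose_spec.opLs_ae ψ
  · exact (exists_isKer₁ a b B).choose_spec.opLs_ae ψ
  · rfl

lemma opT_primAt (j : Fin 3) (s : ℝ) (ψ : L2sx n a b) :
    opT a b B j (primAt s ψ) = primAt s (opTs a b B j ψ) := by
  fin_cases j
  · exact (exists_isKer₀ a b B).choose_spec.opL_primAt s ψ
  · exact (exists_isKer₁ a b B).choose_spec.opL_primAt s ψ
  · rfl

lemma fT_congr {u w : ℝ → E n} (h : u =ᵐ[μ₁ a b] w) (j : Fin 3) :
    fT a b B j u =ᵐ[μ₁ a b] fT a b B j w := by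
  have hk : ∀ k : ℝ → ℝ → E n →L[ℝ] E n, fOp a b k u = fOp a b k w := fun k => by
    ext1 x
    exact integral_congr_ae (h.mono fun t ht => by dsimp only; rw [ht])
  fin_cases j
  · exact Filter.Eventually.of_forall fun x => congrFun (hk _) x
  · exact Filter.Eventually.of_forall fun x => congrFun (hk _) x
  · exact h

/-- The components `∂_s^i ∂_x^j` of the reconstruction `𝒯₁ v + 𝒯₂ ψ`. -/
def reconComp (i : Fin 2) (j : Fin 3) : L2x n a b × L2sx n a b →L[ℝ] L2sx n a b :=
  ![(extend.comp (opT a b B j)).comp (ContinuousLinearMap.fst ℝ _ _)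
      + (prim.comp (opTs a b B j)).comp (ContinuousLinearMap.snd ℝ _ _),
    (opTs a b B j).comp (ContinuousLinearMap.snd ℝ _ _)] i

lemma reconComp_zero (j : Fin 3) (v : L2x n a b) (ψ : L2sx n a b) :
    reconComp B 0 j (v, ψ) = extend (opT a b B j v) + prim (opTs a b B j ψ) := rfl

lemma reconComp_one (j : Fin 3) (v : L2x n a b) (ψ : L2sx n a b) :
    reconComp B 1 j (v, ψ) = opTs a b B j ψ := rfl

/-- `∂ₓʲ 𝒯₁` commutes with `∫_0^s`, hence the slice at `s` is `𝒯₁` of a single `L₂` function. -/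
lemma reconComp_zero_slices (hab : a ≤ b) (v : L2x n a b) (ψ : L2sx n a b) :
    ∀ᵐ s ∂(μ₁ 0 1), ∀ j, ∀ᵐ x ∂(μ₁ a b),
      reconComp B 0 j (v, ψ) (s, x) = H2.d j (liftH2 B hab (v + primAt s ψ)) x := by
  rw [ae_all_iff]
  intro j
  have h0 := ae_ae_of_ae_μ₂ (Lp.coeFn_add (extend (opT a b B j v)) (prim (opTs a b B j ψ)))
  filter_upwards [h0, ae_ae_of_ae_μ₂ (extend_ae (opT a b B j v)),
    prim_ae_primAt (opTs a b B j ψ)] with s h1 h2 h3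
  rw [d_liftH2, map_add, opT_primAt]
  filter_upwards [h1, h2, h3, Lp.coeFn_add (opT a b B j v) (primAt s (opTs a b B j ψ))]
    with x h1 h2 h3 h4
  rw [reconComp_zero, h1, h4, Pi.add_apply, Pi.add_apply, h2, h3]

/-- Almost every slice of `ψ` lies in `L₂[a,b]`, and `𝒯₁` lifts it to `H₂`. -/
lemma opTs_slices (hab : a ≤ b) (ψ : L2sx n a b) :
    ∀ᵐ s ∂(μ₁ 0 1), ∃ u : H2 n a b, ∀ j, ∀ᵐ x ∂(μ₁ a b),
      opTs a b B j ψ (s, x) = H2.d j u x := by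
  have h : ∀ᵐ s ∂(μ₁ 0 1), ∀ j, ∀ᵐ x ∂(μ₁ a b),
      opTs a b B j ψ (s, x) = fT a b B j (fun t => ψ (s, t)) x := by
    rw [ae_all_iff]
    exact fun j => ae_ae_of_ae_μ₂ (opTs_ae B j ψ)
  filter_upwards [h, ae_memLp_L2sx ψ] with s h1 h2
  refine ⟨liftH2 B hab (h2.toLp _), fun j => ?_⟩
  rw [d_liftH2]
  filter_upwards [h1 j, opT_ae B j (h2.toLp _), fT_congr B h2.coeFn_toLp j] with x h3 h4 h5
  rw [h3, h4, h5]

lemma isWeakDeriv₂_reconComp (hab : a ≤ b) (w : L2x n a b × L2sx n a b) (i : Fin 2) (j : Fin 3) :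
    IsWeakDeriv₂ i j (reconComp B 0 0 w) (reconComp B i j w) := by
  obtain ⟨v, ψ⟩ := w
  fin_cases i
  · exact isWeakDeriv₂_of_slices (w := fun j => reconComp B 0 j (v, ψ))
      ((reconComp_zero_slices B hab v ψ).mono fun s hs => ⟨_, hs⟩) j
  · intro η hη
    -- The `s`-derivative is moved first, with `∂_x^j η` as test function. This removes the `v` term
    -- and leaves `𝒯₁ ψ`, whose `x`-derivatives are known slice by slice.
    have h1 := integral_dirDeriv_fst_smul (hη.iterate (0, 1) j) (opT a b B 0 v) (opTs a b B 0 ψ)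
    have h2 := isWeakDeriv₂_of_slices (w := fun j => opTs a b B j ψ) (opTs_slices B hab ψ) j η hη
    refine h1.trans ?_
    rw [pow_add, mul_smul]
    simp only [pow_one, neg_smul, one_smul, neg_inj]
    rw [zero_add] at h2
    exact h2

/-- The reconstruction operator `(v, ψ) ↦ 𝒯₁ v + 𝒯₂ ψ` from `L₂ × L₂` to `H_{(1,2)}`. -/
def reconL (hab : a ≤ b) : L2x n a b × L2sx n a b →L[ℝ] H12 n a b :=
  (ContinuousLinearMap.pi fun p : Fin 2 × Fin 3 => reconComp B p.1 p.2).codRestrict (H12 n a b)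
    fun w i j => isWeakDeriv₂_reconComp B hab w i j

lemma d_reconL (hab : a ≤ b) (w : L2x n a b × L2sx n a b) (i : Fin 2) (j : Fin 3) :
    H12.d i j (reconL B hab w) = reconComp B i j w := rfl

/-- Definitional, because `∂ₓ² 𝒯₁` is encoded as the identity. -/
lemma d_one_two_reconL (hab : a ≤ b) (v : L2x n a b) (ψ : L2sx n a b) :
    H12.d 1 2 (reconL B hab (v, ψ)) = ψ := rfl

/-! ### Agreement of the bounded operators with the pointwise formulas. -/

lemma opT₁_ae (v : L2x n a b) : opT a b B 0 v =ᵐ[μ₁ a b] opT₁ a b B v := by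
  filter_upwards [opT_ae B 0 v, ae_restrict_mem measurableSet_Icc] with x hx hx2
  rw [hx, opT₁_eq B hx2 (integrable_L2x v)]
  rfl

lemma opT₁_slice_ae (ψ : L2sx n a b) :
    ∀ᵐ z ∂(μ₂ a b), opTs a b B 0 ψ z = opT₁ a b B (fun x => ψ (z.1, x)) z.2 := by
  filter_upwards [opTs_ae B 0 ψ, ae_fst_of_ae (ae_memLp_L2sx ψ),
    ae_snd_of_ae (ae_restrict_mem measurableSet_Icc)] with z h1 h2 h3
  rw [h1, opT₁_eq B h3 (h2.integrable (by norm_num))]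
  rfl

lemma opT₂_ae (ψ : L2sx n a b) : prim (opTs a b B 0 ψ) =ᵐ[μ₂ a b] opT₂ a b B ψ := by
  filter_upwards [prim_ae (opTs a b B 0 ψ), ae_fst_of_ae (ae_restrict_mem measurableSet_Icc),
    ae_snd_of_ae (ae_ae_swap_of_ae_μ₂ (opT₁_slice_ae B ψ))] with z h1 h2 h3
  rw [h1, opT₂, primitive_eq h2]
  refine integral_congr_ae (h3.mono fun σ hσ => ?_)
  dsimp only at hσ ⊢
  rw [hσ]

lemma recon_ae (hab : a ≤ b) (v : L2x n a b) (ψ : L2sx n a b) :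
    H12.d 0 0 (reconL B hab (v, ψ)) =ᵐ[μ₂ a b] recon B v ψ := by
  rw [d_reconL, reconComp_zero]
  filter_upwards [Lp.coeFn_add (extend (opT a b B 0 v)) (prim (opTs a b B 0 ψ)),
    extend_ae (opT a b B 0 v), opT₂_ae B ψ, ae_snd_of_ae (opT₁_ae B v)] with z h1 h2 h3 h4
  rw [h1, Pi.add_apply, h2, h3, h4, recon]

lemma opA₂₂_ae (τ : ℝ) (ψ : L2sx n a b) :
    (-(1 / τ) • opTs a b B 0 ψ : L2sx n a b) =ᵐ[μ₂ a b] opA₂₂ a b B τ ψ := by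
  filter_upwards [Lp.coeFn_smul (-(1 / τ)) (opTs a b B 0 ψ), opT₁_slice_ae B ψ] with z h1 h2
  rw [h1, Pi.smul_apply, h2, opA₂₂]

lemma isSlices_reconL (hab : a ≤ b) (v : L2x n a b) (ψ : L2sx n a b) :
    IsSlices (reconL B hab (v, ψ)) fun s => liftH2 B hab (v + primAt s ψ) := by
  refine ⟨(liftH2 B hab).continuous.comp_continuousOn
    (continuousOn_const.add (continuousOn_primAt ψ)), ?_⟩
  filter_upwards [reconComp_zero_slices B hab v ψ] with s hs
  filter_upwards [hs 0] with x hx using hx.symm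

lemma reconL_mem_Y (hab : a < b) (hB : IsUnit (B * Hmat n a b)) (v : L2x n a b)
    (ψ : L2sx n a b) : reconL B hab.le (v, ψ) ∈ Y B (opT₁ a b B v) := by
  refine ⟨_, isSlices_reconL B hab.le v ψ, ?_, fun s _ => memX_liftH2 B hab hB _⟩
  rw [primAt_zero, add_zero, d_liftH2]
  exact opT₁_ae B v

/-- At `s = 1` the derivatives of the slice are `∂ₓʲ 𝒯₁ v` plus the full `s`-integral of `∂ₓʲ 𝒯₁ ψ`.
At fixed `x` the blocks of `Ad x` are constant linear maps and pass under that integral. -/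
lemma outAd_reconL (hab : a ≤ b) (Ad : ℝ → Matrix (Fin n) (Fin 3 × Fin n) ℝ) (v : L2x n a b)
    (ψ : L2sx n a b) :
    ∀ᵐ x ∂(μ₁ a b), outAd Ad (liftH2 B hab (v + primAt 1 ψ)) x
      = opA₁₁d a b B Ad v x + opA₁₂ a b B Ad ψ x := by
  have h1 : ∀ᵐ x ∂(μ₁ a b), ∀ j, opT a b B j (v + primAt 1 ψ) x
      = fT a b B j v x + ∫ σ, opTs a b B j ψ (σ, x) ∂(μ₁ 0 1) := by
    rw [ae_all_iff]
    intro j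
    rw [map_add, opT_primAt]
    filter_upwards [Lp.coeFn_add (opT a b B j v) (primAt 1 (opTs a b B j ψ)), opT_ae B j v,
      primAt_one_ae (opTs a b B j ψ)] with x h1 h2 h3
    rw [h1, Pi.add_apply, h2, h3]
  have h2 : ∀ᵐ x ∂(μ₁ a b), ∀ j, ∀ᵐ s ∂(μ₁ 0 1),
      opTs a b B j ψ (s, x) = fT a b B j (fun t => ψ (s, t)) x := by
    rw [ae_all_iff]
    exact fun j => ae_ae_swap_of_ae_μ₂ (opTs_ae B j ψ)
  have h3 : ∀ᵐ x ∂(μ₁ a b), ∀ j, Integrable (fun s => opTs a b B j ψ (s, x)) (μ₁ 0 1) := by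
    rw [ae_all_iff]
    exact fun j => (integrable_prod_L2sx _).prod_left_ae
  filter_upwards [h1, h2, h3, ae_restrict_mem measurableSet_Icc] with x h1 h2 h3 hx
  rw [outAd_eq, opA₁₁d_eq B Ad hx (integrable_L2x v), opA₁₂, interval_eq zero_le_one]
  have h4 : ∫ s, opA₁₁d a b B Ad (fun y => ψ (s, y)) x ∂(μ₁ 0 1)
      = ∫ s, ∑ j, blk (Ad x) j (opTs a b B j ψ (s, x)) ∂(μ₁ 0 1) := by
    refine integral_congr_ae ?_
    filter_upwards [ae_all_iff.2 h2, ae_memLp_L2sx ψ] with s hs hs2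
    rw [opA₁₁d_eq B Ad hx (hs2.integrable (by norm_num))]
    exact Finset.sum_congr rfl fun j _ => by rw [hs j]
  rw [h4, integral_finsetSum _ fun j _ => (blk (Ad x) j).integrable_comp (h3 j),
    ← Finset.sum_add_distrib]
  refine Finset.sum_congr rfl fun j _ => ?_
  rw [(blk (Ad x) j).integral_comp_comm (h3 j), d_liftH2, h1 j, map_add]

/-! ### Uniqueness in `Y`. -/

/-- Slices are unique. -/
lemma IsSlices.eqOn {φ : H12 n a b} {S S' : ℝ → H2 n a b} (hS : IsSlices φ S)
    (hS' : IsSlices φ S') : EqOn S S' (Icc 0 1) := by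
  refine Measure.eqOn_Icc_of_ae_eq volume zero_ne_one ?_ hS.1 hS'.1
  filter_upwards [hS.2, hS'.2] with s h1 h2
  refine H2.ext_zero (Lp.ext ?_)
  filter_upwards [h1, h2] with x h1 h2
  rw [h1, h2]

lemma IsSlices.sub {φ φ' : H12 n a b} {S S' : ℝ → H2 n a b} (hS : IsSlices φ S)
    (hS' : IsSlices φ' S') : IsSlices (φ - φ') fun s => S s - S' s := by
  refine ⟨hS.1.sub hS'.1, ?_⟩
  have h : ∀ᵐ z ∂(μ₂ a b), H12.d 0 0 (φ - φ') z = H12.d 0 0 φ z - H12.d 0 0 φ' z :=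
    Lp.coeFn_sub _ _
  filter_upwards [hS.2, hS'.2, ae_ae_of_ae_μ₂ h] with s h1 h2 h3
  have h4 : ∀ᵐ x ∂(μ₁ a b), H2.d 0 (S s - S' s) x = H2.d 0 (S s) x - H2.d 0 (S' s) x :=
    Lp.coeFn_sub _ _
  filter_upwards [h1, h2, h3, h4] with x h1 h2 h3 h4
  rw [h3, h4, h1, h2]

/-- A function with `∂_s ∂_x² φ = 0`, zero initial value and slices in `X_B` vanishes. -/
lemma IsSlices.eq_zero (hab : a < b) (hB : IsUnit (B * Hmat n a b)) {φ : H12 n a b}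
    {S : ℝ → H2 n a b} (hS : IsSlices φ S) (h0 : H2.d 0 (S 0) = 0)
    (hX : ∀ s ∈ Icc (0 : ℝ) 1, MemX B (S s)) (hφ : H12.d 1 2 φ = 0) : φ = 0 := by
  have hS0 : ∀ s ∈ Icc (0 : ℝ) 1, S s = 0 := by
    -- With product test functions `α(s) β(x)`, the hypothesis on `∂_s ∂_x² φ` says that `s ↦ ∫ β''
    -- φ(s,·)` has zero weak derivative. Being continuous, it keeps its value at `s = 0`, which is
    -- zero.
    have key : ∀ β, IsTest (Ioo a b) β → ∀ s ∈ Icc (0 : ℝ) 1,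
        ∫ x, (dirDeriv (1 : ℝ))^[2] β x • H2.d 0 (S s) x ∂(μ₁ a b) = 0 := by
      intro β hβ s hs
      have hcont : ContinuousOn (fun s =>
          ∫ x, (dirDeriv (1 : ℝ))^[2] β x • H2.d 0 (S s) x ∂(μ₁ a b)) (Icc 0 1) :=
        (hβ.iterate 1 2).continuous_integral.comp_continuousOn
          ((continuous_apply 0).comp_continuousOn (continuous_subtype_val.comp_continuousOn hS.1))
      have := eqOn_const_of_weak_deriv_zero zero_lt_one hcont (fun α hα => ?_) s hs
      · rw [this, h0, integral_smul_zero]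
      · have h1 := φ.2 1 2 _ (hα.mul_prod hβ)
        have hφ' : φ.1 (1, 2) = 0 := hφ
        rw [hφ', integral_smul_zero, smul_zero] at h1
        have ht : IsTest _ (partialDeriv 1 2 fun z : ℝ × ℝ => α z.1 * β z.2) :=
          ((hα.mul_prod hβ).iterate (0, 1) 2).iterate (1, 0) 1
        rw [← h1]
        refine Eq.trans ?_ (integral_μ₂ (ht.integrable_smul (φ.1 (0, 0)))).symm
        refine integral_congr_ae ?_
        filter_upwards [hS.2] with s hs
        rw [← integral_smul]
        refine integral_congr_ae (hs.mono fun x hx => ?_)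
        dsimp only
        rw [partialDeriv_one_two_mul hα hβ, hx, mul_smul]
        rfl
    intro s hs
    -- `key` says that each slice has vanishing second derivative, and membership in `X_B` then
    -- forces it to be zero.
    refine (hX s hs).eq_zero B hab hB (L2x_eq_of_test fun β hβ => ?_)
    have h1 := (S s).2 2 β hβ
    have h2 := key β hβ s hs
    rw [integral_smul_zero]
    refine Eq.trans ?_ h2
    refine Eq.trans ?_ h1.symm
    simp
    rfl
  refine H12.ext_zero (L2sx_eq_of_test fun η hη => ?_)
  have hz : H12.d 0 0 (0 : H12 n a b) = 0 := rfl
  rw [hz, integral_smul_zero, integral_μ₂ (hη.integrable_smul _)]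
  refine integral_eq_zero_of_ae ?_
  filter_upwards [hS.2, ae_restrict_mem measurableSet_Icc] with s h1 h2
  rw [hS0 s h2] at h1
  refine integral_eq_zero_of_ae ?_
  filter_upwards [h1, Lp.coeFn_zero (E n) 2 (μ₁ a b)] with x h3 h4
  have h5 : H2.d 0 (0 : H2 n a b) x = 0 := h4
  rw [← h3, h5, smul_zero]
  rfl

/-- An element of `Y_{𝒯₁ v}` is the reconstruction of `v` and `∂_s ∂_x² φ`. -/
lemma eq_reconL_of_mem_Y (hab : a < b) (hB : IsUnit (B * Hmat n a b)) {v : L2x n a b}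
    {φ : H12 n a b} (hφ : φ ∈ Y B (opT₁ a b B v)) :
    φ = reconL B hab.le (v, H12.d 1 2 φ) := by
  obtain ⟨S, hS, h0, hX⟩ := hφ
  obtain ⟨S', hS', h0', hX'⟩ := reconL_mem_Y B hab hB v (H12.d 1 2 φ)
  -- Both functions start at `𝒯₁ v`, have slices in `X_B` and share `∂_s ∂_x²`; uniqueness applies
  -- to their difference.
  refine sub_eq_zero.1 ((hS.sub hS').eq_zero B hab hB ?_ (fun s hs => (hX s hs).sub B (hX' s hs)) ?_)
  · have : H2.d 0 (S 0 - S' 0) = H2.d 0 (S 0) - H2.d 0 (S' 0) := rfl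
    rw [this, sub_eq_zero]
    exact Lp.ext (h0.trans h0'.symm)
  · have : H12.d 1 2 (φ - reconL B hab.le (v, H12.d 1 2 φ))
        = H12.d 1 2 φ - H12.d 1 2 (reconL B hab.le (v, H12.d 1 2 φ)) := rfl
    rw [this, d_one_two_reconL, sub_self]

/-! ### A bounded left inverse of the reconstruction. -/

/-- The derivative `∂_s^i ∂_x^j` as a continuous linear map on `H_{(1,2)}`. -/
def H12.dL (i : Fin 2) (j : Fin 3) : H12 n a b →L[ℝ] L2sx n a b :=
  (ContinuousLinearMap.proj (R := ℝ) (φ := fun _ => L2sx n a b) (i, j)).comp (H12 n a b).subtypeL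

/-- The operator that recovers `v` from `𝒯₁ v + 𝒯₂ ψ`. -/
def inputL : H12 n a b →L[ℝ] L2x n a b :=
  (primAt 1).comp (H12.dL 0 2) - ((primAt 1).comp prim).comp (H12.dL 1 2)

/-- Here `∂_x² φ = v + ∫_0^s ψ`. Averaging over `s ∈ [0,1]` and subtracting the average of `∫_0^s
∂_s ∂_x² φ` recovers `v` without taking a trace at `s = 0`, so boundedness is immediate. -/
lemma inputL_reconL (hab : a ≤ b) (v : L2x n a b) (ψ : L2sx n a b) :
    inputL (reconL B hab (v, ψ)) = v := by
  have h : inputL (reconL B hab (v, ψ)) = primAt 1 (extend v + prim ψ) - primAt 1 (prim ψ) := rfl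
  rw [h, map_add, add_sub_cancel_right, primAt_one_extend]

lemma reconL_injective (hab : a ≤ b) : Function.Injective (reconL (a := a) B hab) := by
  rintro ⟨v, ψ⟩ ⟨v', ψ'⟩ h
  have h1 := congrArg inputL h
  have h2 := congrArg (H12.d 1 2) h
  rw [inputL_reconL, inputL_reconL] at h1
  rw [d_one_two_reconL, d_one_two_reconL] at h2
  rw [h1, h2]

lemma eq_reconL_of_ae (hab : a ≤ b) {φ : H12 n a b} {v : L2x n a b} {ψ : L2sx n a b}
    (h : H12.d 0 0 φ =ᵐ[μ₂ a b] recon B v ψ) : φ = reconL B hab (v, ψ) :=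
  H12.ext_zero (Lp.ext (h.trans (recon_ae B hab v ψ).symm))

lemma recon_ae_iff (hab : a ≤ b) {v v' : L2x n a b} {ψ ψ' : L2sx n a b} :
    recon B v ψ =ᵐ[μ₂ a b] recon B v' ψ' ↔ v = v' ∧ ψ = ψ' := by
  refine ⟨fun h => ?_, fun h => by rw [h.1, h.2]⟩
  exact Prod.ext_iff.1 (reconL_injective B hab
    (eq_reconL_of_ae B hab ((recon_ae B hab v ψ).trans h)))

end Reconstruction

/-! ### Equivalence of the two systems -/

section Equivalence

variable {n : ℕ} {a b τ : ℝ} (B : Matrix (Fin 2 × Fin n) (Fin 4 × Fin n) ℝ)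
  (Ad : ℝ → Matrix (Fin n) (Fin 3 × Fin n) ℝ)

lemma hasDerivWithinAt_reconL (hab : a ≤ b) {v : ℝ → L2x n a b} {ψ : ℝ → L2sx n a b}
    (hv : DifferentiableOn ℝ v (Ici 0)) (hψ : DifferentiableOn ℝ ψ (Ici 0)) {t : ℝ} (ht : 0 ≤ t) :
    HasDerivWithinAt (fun t => reconL B hab (v t, ψ t))
      (reconL B hab (derivWithin v (Ici 0) t, derivWithin ψ (Ici 0) t)) (Ici 0) t :=
  (reconL B hab).hasFDerivAt.comp_hasDerivWithinAt t
    ((hv t ht).hasDerivWithinAt.prodMk (hψ t ht).hasDerivWithinAt)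

/-- The PDE and PIE equations agree for reconstructed states. -/
lemma transport_iff (hab : a ≤ b) (v' : L2x n a b) (ψ' : L2sx n a b) (v : L2x n a b)
    (ψ : L2sx n a b) :
    H12.d 0 0 (reconL B hab (v', ψ')) = -(1 / τ) • H12.d 1 0 (reconL B hab (v, ψ)) ↔
      ∀ᵐ z ∂(μ₂ a b), opT₁ a b B v' z.2 + opT₂ a b B ψ' z = opA₂₂ a b B τ ψ z := by
  have h1 := recon_ae B hab v' ψ'
  have h2 := opA₂₂_ae B τ ψ
  rw [d_reconL (i := 1), reconComp_one]
  constructor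
  · intro h
    rw [h] at h1
    filter_upwards [h1, h2] with z h1 h2
    rw [← h2, h1, recon]
  · intro h
    refine Lp.ext ?_
    filter_upwards [h, h1, h2] with z h h1 h2
    rw [h1, h2, ← h, recon]

/-- Differentiability passes forward through `reconL` and back through `inputL` and `∂_s ∂_x²`. The
equations then match term by term. -/
theorem isPIESol_iff_isPDESol (hab : a < b) (hB : IsUnit (B * Hmat n a b)) (v : ℝ → L2x n a b)
    (ψ : ℝ → L2sx n a b) (p : ℝ → L2x n a b) (ψ₀ : L2sx n a b) :
    IsPIESol B Ad τ v ψ p ψ₀ ↔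
      IsPDESol B Ad τ v (fun t => recon B (v t) (ψ t)) p (recon B (v 0) ψ₀) := by
  constructor
  · rintro ⟨hv, hψ, h0, h⟩
    refine ⟨fun t => reconL B hab.le (v t, ψ t), fun t _ => recon_ae B hab.le _ _,
      fun t ht => (hasDerivWithinAt_reconL B hab.le hv hψ ht).differentiableWithinAt,
      by simp only [h0]; rfl, fun t ht => ⟨reconL_mem_Y B hab hB _ _, ?_, _,
        isSlices_reconL B hab.le _ _, ?_⟩⟩
    · rw [(hasDerivWithinAt_reconL B hab.le hv hψ ht).derivWithin (uniqueDiffOn_Ici 0 t ht)]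
      exact (transport_iff B hab.le _ _ _ _).2 (h t ht).1
    · filter_upwards [(h t ht).2, outAd_reconL B hab.le Ad (v t) (ψ t)] with x h1 h2
      rw [h1, h2]
  · rintro ⟨Φ, hΦ, hd, h0, h⟩
    -- An element of `H_{(1,2)}` is determined by its underlying function, so the given trajectory
    -- is the reconstruction.
    have hΦ' : ∀ t, 0 ≤ t → Φ t = reconL B hab.le (v t, ψ t) := fun t ht =>
      eq_reconL_of_ae B hab.le (hΦ t ht)
    have hv : DifferentiableOn ℝ v (Ici 0) := by
      refine ((inputL (n := n) (a := a) (b := b)).differentiable.comp_differentiableOn hd).congr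
        fun t ht => ?_
      rw [Function.comp_apply, hΦ' t ht, inputL_reconL]
    have hψ : DifferentiableOn ℝ ψ (Ici 0) := by
      refine ((H12.dL (n := n) (a := a) (b := b) 1 2).differentiable.comp_differentiableOn hd).congr
        fun t ht => ?_
      rw [Function.comp_apply, hΦ' t ht]
      rfl
    refine ⟨hv, hψ, ((recon_ae_iff B hab.le).1 h0).2, fun t ht => ?_⟩
    obtain ⟨-, h2, S, hS, hp⟩ := h t ht
    have hder : derivWithin Φ (Ici 0) t
        = reconL B hab.le (derivWithin v (Ici 0) t, derivWithin ψ (Ici 0) t) :=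
      ((hasDerivWithinAt_reconL B hab.le hv hψ ht).congr hΦ' (hΦ' t ht)).derivWithin
        (uniqueDiffOn_Ici 0 t ht)
    rw [hder, hΦ' t ht] at h2
    refine ⟨(transport_iff B hab.le _ _ _ _).1 h2, ?_⟩
    rw [hΦ' t ht] at hS
    -- The slices in the output equation are merely some representative; uniqueness identifies their
    -- value at `s = 1` with the explicit one.
    have hS1 := hS.eqOn (isSlices_reconL B hab.le (v t) (ψ t)) (right_mem_Icc.2 zero_le_one)
    rw [hS1] at hp
    filter_upwards [hp, outAd_reconL B hab.le Ad (v t) (ψ t)] with x h1 h2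
    rw [h1, h2]

lemma IsPDESol.congr {v : ℝ → L2x n a b} {φ φ' : ℝ → ℝ × ℝ → E n} {p : ℝ → L2x n a b}
    {φ₀ φ₀' : ℝ × ℝ → E n} (h : IsPDESol B Ad τ v φ p φ₀)
    (hφ : ∀ t, 0 ≤ t → φ t =ᵐ[μ₂ a b] φ' t) (h₀ : φ₀ =ᵐ[μ₂ a b] φ₀') :
    IsPDESol B Ad τ v φ' p φ₀' := by
  obtain ⟨Φ, hΦ, hd, h0, h⟩ := h
  exact ⟨Φ, fun t ht => (hΦ t ht).trans (hφ t ht), hd, (hφ 0 le_rfl).symm.trans (h0.trans h₀), h⟩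

end Equivalence

end DelayPIE

end

theorem mainTheorem5 (n : ℕ) (a b τ : ℝ) (hab : a < b) (hτ : 0 < τ)
    (Ad : ℝ → Matrix (Fin n) (Fin 3 × Fin n) ℝ)
    (hAd : ∀ i k, MeasureTheory.MemLp (fun x => Ad x i k) ⊤ (DelayPIE.μ₁ a b))
    (B : Matrix (Fin 2 × Fin n) (Fin 4 × Fin n) ℝ)
    (hB : IsUnit (B * DelayPIE.Hmat n a b))
    (v : ℝ → DelayPIE.L2x n a b) :
    (∀ (ψ : ℝ → DelayPIE.L2sx n a b) (p : ℝ → DelayPIE.L2x n a b) (ψ₀ : DelayPIE.L2sx n a b),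
      DelayPIE.IsPIESol B Ad τ v ψ p ψ₀ ↔
        DelayPIE.IsPDESol B Ad τ v (fun t => DelayPIE.recon B (v t) (ψ t)) p
          (DelayPIE.recon B (v 0) ψ₀)) ∧
    (∀ (φ : ℝ → DelayPIE.H12 n a b) (p : ℝ → DelayPIE.L2x n a b) (φ₀ : DelayPIE.H12 n a b),
      (∀ t, 0 ≤ t → φ t ∈ DelayPIE.Y B (DelayPIE.opT₁ a b B (v t))) →
      φ₀ ∈ DelayPIE.Y B (DelayPIE.opT₁ a b B (v 0)) →
      (DelayPIE.IsPDESol B Ad τ v (fun t => DelayPIE.H12.d 0 0 (φ t)) p (DelayPIE.H12.d 0 0 φ₀) ↔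
        DelayPIE.IsPIESol B Ad τ v (fun t => DelayPIE.H12.d 1 2 (φ t)) p
          (DelayPIE.H12.d 1 2 φ₀))) := by
  refine ⟨DelayPIE.isPIESol_iff_isPDESol B Ad hab hB v, fun φ p φ₀ hφ hφ₀ => ?_⟩
  -- Elements of `Y` are reconstructions of their own `∂_s ∂_x²`. This turns the second claim into
  -- the first, since PDE solutions depend on the state only up to null sets.
  have key : ∀ {ϕ : DelayPIE.H12 n a b} {u : DelayPIE.L2x n a b},
      ϕ ∈ DelayPIE.Y B (DelayPIE.opT₁ a b B u) →
      DelayPIE.H12.d 0 0 ϕ =ᵐ[DelayPIE.μ₂ a b] DelayPIE.recon B u (DelayPIE.H12.d 1 2 ϕ) := by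
    intro ϕ u h
    conv_lhs => rw [DelayPIE.eq_reconL_of_mem_Y B hab hB h]
    exact DelayPIE.recon_ae B hab.le _ _
  rw [DelayPIE.isPIESol_iff_isPDESol B Ad hab hB]
  exact ⟨fun h => h.congr B Ad (fun t ht => key (hφ t ht)) (key hφ₀),
    fun h => h.congr B Ad (fun t ht => (key (hφ t ht)).symm) (key hφ₀).symm⟩
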